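/- Let $\Omega\subset\mathbb C$ be a domain (a nonempty connected open set) and let $\delta_\Omega(z)\in(0,\infty]$ denote the distance from $z\in\Omega$ to $\partial\Omega$. Define the Hardy constant $h(\Omega)\in[0,\infty]$ by $$h(\Omega)^2:=\inf\left\{\frac{\int_\Omega|\nabla\phi|^2}{\int_\Omega\phi^2/\delta_\Omega^2}:\ \phi\in C_0^\infty(\Omega)\setminus\{0\}\text{ real-valued}\right\}.$$ Let $K_\Omega(z,w)$ be the Bergman kernel of $\Omega$, i.e. for each $w\in\Omega$, $K_\Omega(\cdot,w)$ is the unique element of the space $A^2(\Omega)$ of square-integrable holomorphic functions on $\Omega$ such that $f(w)=\int_\Omega f\,\overline{K_\Omega(\cdot,w)}$ for all $f\in A^2(\Omega)$. Define the integrability index $$\beta(\Omega):=\sup\{\beta\ge 2:\ K_\Omega(\cdot,w)\in L^\beta(\Omega)\ \ \forall\, w\in\Omega\}\in[2,\infty].$$ Then $$\beta(\Omega)\ \ge\ \frac{6}{3-h(\Omega)}.$$ (If $\Omega\ne\mathbb C$, then $h(\Omega)\le 1$ and the right-hand side is a finite positive number. If $\Omega=\mathbb C$, then $\delta_\Omega\equiv\infty$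 and $h(\Omega)=\infty$, and the right-hand side is read as $+\infty$.) -/

import Mathlib

open MeasureTheory Metric
open scoped ENNReal NNReal ContDiff ComplexConjugate

noncomputable section

/-- The boundary distance `δ_Ω`, with values in `[0, ∞]`
(it is identically `∞` when the boundary is empty, that is, for `Ω = ℂ`). -/
def boundaryDist (Ω : Set ℂ) (z : ℂ) : ℝ≥0∞ :=
  infEDist z (frontier Ω)

/-- Real-valued smooth functions with compact support contained in `Ω`. -/
def IsTestFunction (Ω : Set ℂ) (φ : ℂ → ℝ) : Prop :=
  ContDiff ℝ ∞ φ ∧ HasCompactSupport φ ∧ tsupport φ ⊆ Ω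

/-- The Hardy quotient `∫_Ω |∇φ|² / ∫_Ω φ² / δ_Ω²`. The operator norm of the real derivative of
`φ` is the Euclidean length of its gradient. -/
def hardyQuotient (Ω : Set ℂ) (φ : ℂ → ℝ) : ℝ≥0∞ :=
  (∫⁻ z in Ω, ‖fderiv ℝ φ z‖ₑ ^ 2) / ∫⁻ z in Ω, ‖φ z‖ₑ ^ 2 / boundaryDist Ω z ^ 2

/-- The Hardy constant `h(Ω)`: its square is the infimum of the Hardy quotient over all nonzero
test functions. -/
def hardyConstant (Ω : Set ℂ) : ℝ≥0∞ :=
  (⨅ (φ : ℂ → ℝ) (_ : IsTestFunction Ω φ ∧ φ ≠ 0), hardyQuotient Ω φ) ^ (1 / 2 : ℝ)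

/-- Membership in the Bergman space `A²(Ω)` of square integrable holomorphic functions on `Ω`. -/
def MemBergman (Ω : Set ℂ) (f : ℂ → ℂ) : Prop :=
  DifferentiableOn ℂ f Ω ∧ MemLp f 2 (volume.restrict Ω)

/-- `k` represents evaluation at `w` on the Bergman space `A²(Ω)`. -/
def IsReproducingAt (Ω : Set ℂ) (w : ℂ) (k : ℂ → ℂ) : Prop :=
  MemBergman Ω k ∧ ∀ f : ℂ → ℂ, MemBergman Ω f → f w = ∫ z in Ω, f z * conj (k z)

open Classical in
/-- The Bergman kernel `K_Ω(z, w)`: for `w ∈ Ω`, the function `K_Ω(·, w)` is the element of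
`A²(Ω)` that represents evaluation at `w`. It exists and is unique on an open set, see
`bergmanKernel_spec` and `IsReproducingAt.eqOn` below. -/
def bergmanKernel (Ω : Set ℂ) (z w : ℂ) : ℂ :=
  if h : ∃ k, IsReproducingAt Ω w k then h.choose z else 0

/-- The integrability index of the Bergman kernel: the supremum, in `[0, ∞]`, of all real
`p ≥ 2` such that `K_Ω(·, w) ∈ L^p(Ω)` for every `w ∈ Ω`. -/
def integrabilityIndex (Ω : Set ℂ) : ℝ≥0∞ :=
  ⨆ (p : ℝ≥0) (_ : 2 ≤ p ∧ ∀ w ∈ Ω,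
    MemLp (fun z => bergmanKernel Ω z w) (p : ℝ≥0∞) (volume.restrict Ω)), (p : ℝ≥0∞)

/-! Existence and uniqueness of the Bergman kernel. -/

/-- Circular mean value inequality. -/
theorem enorm_le_lintegral_circle {f : ℂ → ℂ} {w : ℂ} {r s : ℝ} (hs : 0 < s) (hsr : s < r)
    (hf : DifferentiableOn ℂ f (ball w r)) :
    ENNReal.ofReal (2 * Real.pi) * ‖f w‖ₑ ≤
      ∫⁻ θ in Set.Ioo (-Real.pi) Real.pi, ‖f (w + Complex.polarCoord.symm (s, θ))‖ₑ := by
  have hd : DiffContOnCl ℂ f (ball w |s|) := by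
    rw [abs_of_pos hs]
    exact (hf.mono (closure_ball_subset_closedBall.trans
      (closedBall_subset_ball hsr))).diffContOnCl
  have h1 := hd.circleAverage
  rw [Real.circleAverage_def] at h1
  have hpi := Real.pi_pos
  have h2 : (2 * Real.pi : ℝ) • f w = ∫ θ in (0 : ℝ)..2 * Real.pi, f (circleMap w s θ) := by
    rw [← h1, smul_smul, mul_inv_cancel₀ (by positivity), one_smul]
  have hper : Function.Periodic (fun θ => f (circleMap w s θ)) (2 * Real.pi) := fun θ => by
    simp only [periodic_circleMap w s θ]
  have h3 := hper.intervalIntegral_add_eq 0 (-Real.pi)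
  rw [zero_add, show -Real.pi + 2 * Real.pi = Real.pi by ring] at h3
  rw [h3, intervalIntegral.integral_of_le (by linarith)] at h2
  have h4 : ‖(2 * Real.pi : ℝ) • f w‖ₑ = ENNReal.ofReal (2 * Real.pi) * ‖f w‖ₑ := by
    rw [enorm_smul, Real.enorm_of_nonneg (by positivity)]
  rw [← h4, h2, integral_Ioc_eq_integral_Ioo]
  refine (enorm_integral_le_lintegral_enorm _).trans (le_of_eq ?_)
  refine lintegral_congr fun θ => ?_
  simp [circleMap, Complex.exp_mul_I]

/-- The weight of a disc of radius `r`, written as an integral in the radius. -/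
def discMass (r : ℝ) : ℝ≥0∞ :=
  ∫⁻ s in Set.Ioo 0 r, ENNReal.ofReal s * ENNReal.ofReal (2 * Real.pi)

theorem discMass_ne_zero {r : ℝ} (hr : 0 < r) : discMass r ≠ 0 := by
  have hpi := Real.pi_pos
  unfold discMass
  rw [← pos_iff_ne_zero, setLIntegral_pos_iff (by fun_prop)]
  have : (Function.support fun s : ℝ => ENNReal.ofReal s * ENNReal.ofReal (2 * Real.pi)) ∩
      Set.Ioo 0 r = Set.Ioo 0 r := by
    refine Set.inter_eq_right.2 fun s hs => ?_
    have := hs.1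
    simp [Function.mem_support, hs.1, hpi]
  rw [this]
  simp [hr]

/-- Mean value inequality on discs. -/
theorem enorm_mul_discMass_le {f : ℂ → ℂ} {w : ℂ} {r : ℝ}
    (hf : DifferentiableOn ℂ f (ball w r)) :
    ‖f w‖ₑ * discMass r ≤ ∫⁻ z in ball w r, ‖f z‖ₑ := by
  set F : ℂ → ℝ≥0∞ := (ball w r).indicator fun z => ‖f z‖ₑ with hF
  have hFm : Measurable F := by
    have hc : ContinuousOn (fun z => ‖f z‖ₑ) (ball w r) := hf.continuousOn.enorm
    classical
    have := hc.measurable_piecewise (continuousOn_const (c := (0 : ℝ≥0∞)) (s := (ball w r)ᶜ))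
      measurableSet_ball
    convert this using 1
    ext z
    simp [hF, Set.indicator, Set.piecewise]
  have e1 : ∫⁻ z in ball w r, ‖f z‖ₑ = ∫⁻ z, F (w + z) := by
    rw [lintegral_add_left_eq_self F w, hF, lintegral_indicator measurableSet_ball]
  rw [e1, ← Complex.lintegral_comp_polarCoord_symm, polarCoord_target, Measure.volume_eq_prod,
    ← Measure.prod_restrict]
  have hms : Measurable fun p : ℝ × ℝ => Complex.polarCoord.symm p := by
    simp only [Complex.polarCoord_symm_apply]
    fun_prop
  rw [lintegral_prod _ (by fun_prop)]
  rw [discMass, ← lintegral_const_mul _ (by fun_prop)]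
  refine le_trans ?_ (lintegral_mono_set (s := Set.Ioo 0 r) (fun s hs => hs.1))
  refine setLIntegral_mono' measurableSet_Ioo fun s hs => ?_
  simp only [smul_eq_mul]
  rw [lintegral_const_mul _ (by fun_prop)]
  have h := enorm_le_lintegral_circle hs.1 hs.2 hf
  calc ‖f w‖ₑ * (ENNReal.ofReal s * ENNReal.ofReal (2 * Real.pi))
      = ENNReal.ofReal s * (ENNReal.ofReal (2 * Real.pi) * ‖f w‖ₑ) := by ring
    _ ≤ _ := by
        refine mul_le_mul_right (h.trans (le_of_eq ?_)) _
        refine lintegral_congr fun θ => ?_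
        rw [hF, Set.indicator_of_mem]
        rw [mem_ball, dist_eq_norm, add_sub_cancel_left, Complex.norm_polarCoord_symm,
          abs_of_pos hs.1]
        exact hs.2

theorem discMass_ne_top (r : ℝ) : discMass r ≠ ⊤ := by
  have h := enorm_mul_discMass_le (f := fun _ => (1 : ℂ)) (w := 0) (r := r)
    (differentiableOn_const 1)
  simp only [enorm_one, one_mul, lintegral_const, MeasurableSet.univ, Measure.restrict_apply,
    Set.univ_inter] at h
  exact (h.trans_lt measure_ball_lt_top).ne

/-- Point evaluations are bounded in the `L²` norm. -/
theorem enorm_sq_mul_discMass_le {Ω : Set ℂ} {f : ℂ → ℂ} {w : ℂ} {r : ℝ}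
    (hf : DifferentiableOn ℂ f Ω) (hr : ball w r ⊆ Ω) :
    ‖f w‖ₑ ^ 2 * discMass r ≤ eLpNorm f 2 (volume.restrict Ω) ^ 2 := by
  have h := enorm_mul_discMass_le (f := fun z => f z ^ 2) ((hf.mono hr).pow 2)
  simp only [enorm_pow] at h
  refine h.trans ((lintegral_mono_set hr).trans (le_of_eq ?_))
  have := eLpNorm_nnreal_pow_eq_lintegral (μ := volume.restrict Ω) (f := f) (p := 2) (by norm_num)
  norm_num at this
  exact_mod_cast this.symm

/-- Holomorphic functions on an open set that agree almost everywhere agree. -/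
theorem eqOn_of_ae_eq {Ω : Set ℂ} (hΩ : IsOpen Ω) {f g : ℂ → ℂ} (hf : DifferentiableOn ℂ f Ω)
    (hg : DifferentiableOn ℂ g Ω) (h : f =ᵐ[volume.restrict Ω] g) : Set.EqOn f g Ω := by
  intro w hw
  obtain ⟨r, hr, hrΩ⟩ := Metric.isOpen_iff.1 hΩ w hw
  have h1 := enorm_sq_mul_discMass_le (hf.sub hg) hrΩ
  have h0 : eLpNorm (f - g) 2 (volume.restrict Ω) = 0 := by
    rw [eLpNorm_congr_ae (g := 0) (by filter_upwards [h] with z hz; simp [hz])]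
    simp
  rw [h0] at h1
  have h2 : ‖(f - g) w‖ₑ ^ 2 * discMass r = 0 := by simpa using h1
  rcases mul_eq_zero.1 h2 with h3 | h3
  · exact sub_eq_zero.1 (by simpa using h3)
  · exact absurd h3 (discMass_ne_zero hr)

/-- The Bergman space as a subspace of `L²(Ω)`. -/
def bergmanSubmodule (Ω : Set ℂ) : Submodule ℂ (Lp ℂ 2 (volume.restrict Ω)) where
  carrier := {f | ∃ g : ℂ → ℂ, DifferentiableOn ℂ g Ω ∧ f =ᵐ[volume.restrict Ω] g}
  add_mem' := by
    rintro a b ⟨g, hg, hag⟩ ⟨k, hk, hbk⟩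
    exact ⟨g + k, hg.add hk, (Lp.coeFn_add a b).trans (hag.add hbk)⟩
  zero_mem' := ⟨0, differentiableOn_const 0, Lp.coeFn_zero _ _ _⟩
  smul_mem' := by
    rintro c a ⟨g, hg, hag⟩
    exact ⟨c • g, hg.const_smul c, (Lp.coeFn_smul c a).trans (hag.const_smul c)⟩

theorem isClosed_bergmanSubmodule {Ω : Set ℂ} (hΩ : IsOpen Ω) :
    IsClosed (bergmanSubmodule Ω : Set (Lp ℂ 2 (volume.restrict Ω))) := by
  refine IsSeqClosed.isClosed fun u f hu huf => ?_
  choose g hg hug using hu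
  have hloc : ∀ w ∈ Ω, ∃ r > 0, ball w r ⊆ Ω ∧
      UniformCauchySeqOn g Filter.atTop (ball w r) := by
    intro w hw
    obtain ⟨R, hR, hRΩ⟩ := Metric.isOpen_iff.1 hΩ w hw
    refine ⟨R / 2, by positivity, (ball_subset_ball (by linarith)).trans hRΩ, ?_⟩
    have hc := huf.cauchySeq
    rw [Metric.uniformCauchySeqOn_iff]
    intro ε hε
    have hm := discMass_ne_zero (half_pos hR)
    have hmt := discMass_ne_top (R / 2)
    set m : ℝ := (discMass (R / 2)).toReal with hmdef
    have hmpos : 0 < m := ENNReal.toReal_pos hm hmt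
    obtain ⟨N, hN⟩ := Metric.cauchySeq_iff.1 hc (ε * Real.sqrt m) (by positivity)
    refine ⟨N, fun i hi j hj z hz => ?_⟩
    have hzΩ : ball z (R / 2) ⊆ Ω := by
      refine subset_trans (ball_subset_ball' ?_) hRΩ
      have := mem_ball.1 hz
      linarith
    have h1 := enorm_sq_mul_discMass_le ((hg i).sub (hg j)) hzΩ
    have h2 : eLpNorm (g i - g j) 2 (volume.restrict Ω) = ‖u i - u j‖ₑ := by
      rw [Lp.enorm_def]
      refine eLpNorm_congr_ae ?_
      filter_upwards [hug i, hug j, Lp.coeFn_sub (u i) (u j)] with x h1 h2 h3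
      rw [h3, Pi.sub_apply, Pi.sub_apply, h1, h2]
    rw [h2] at h1
    have h3 := ENNReal.toReal_mono (by simp) h1
    simp only [ENNReal.toReal_mul, ENNReal.toReal_pow, toReal_enorm, Pi.sub_apply] at h3
    rw [← hmdef] at h3
    have h4 := hN i hi j hj
    rw [dist_eq_norm] at h4 ⊢
    have h5 : ‖u i - u j‖ ^ 2 < (ε * Real.sqrt m) ^ 2 :=
      pow_lt_pow_left₀ h4 (norm_nonneg _) two_ne_zero
    rw [mul_pow, Real.sq_sqrt hmpos.le] at h5
    have h6 : ‖g i z - g j z‖ ^ 2 < ε ^ 2 := lt_of_mul_lt_mul_right (h3.trans_lt h5) hmpos.le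
    exact lt_of_pow_lt_pow_left₀ 2 hε.le h6
  have hpt : ∀ w, ∃ l, w ∈ Ω → Filter.Tendsto (fun n => g n w) Filter.atTop (nhds l) := by
    intro w
    by_cases hw : w ∈ Ω
    · obtain ⟨r, hr, -, hc⟩ := hloc w hw
      obtain ⟨l, hl⟩ := cauchySeq_tendsto_of_complete (hc.cauchySeq (mem_ball_self hr))
      exact ⟨l, fun _ => hl⟩
    · exact ⟨0, fun h => absurd h hw⟩
  choose G hG using hpt
  have hlu : TendstoLocallyUniformlyOn g G Filter.atTop Ω := by
    refine tendstoLocallyUniformlyOn_of_forall_exists_nhds fun w hw => ?_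
    obtain ⟨r, hr, hrΩ, hc⟩ := hloc w hw
    exact ⟨ball w r, mem_nhdsWithin_of_mem_nhds (ball_mem_nhds w hr),
      hc.tendstoUniformlyOn_of_tendsto fun z hz => hG z (hrΩ hz)⟩
  refine ⟨G, hlu.differentiableOn (Filter.Eventually.of_forall hg) hΩ, ?_⟩
  have hmeas : TendstoInMeasure (volume.restrict Ω) (fun n => (u n : ℂ → ℂ)) Filter.atTop f :=
    tendstoInMeasure_of_tendsto_Lp huf
  obtain ⟨ns, hns, hae⟩ := hmeas.exists_seq_tendsto_ae
  have hall : ∀ᵐ z ∂(volume.restrict Ω), ∀ n, u n z = g n z := ae_all_iff.2 hug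
  filter_upwards [hae, hall, ae_restrict_mem hΩ.measurableSet] with z h1 h2 h3
  refine tendsto_nhds_unique h1 ?_
  simp only [h2]
  exact (hG z h3).comp hns.tendsto_atTop

theorem exists_isReproducingAt {Ω : Set ℂ} (hΩ : IsOpen Ω) {w : ℂ} (hw : w ∈ Ω) :
    ∃ k, IsReproducingAt Ω w k := by
  obtain ⟨r, hr, hrΩ⟩ := Metric.isOpen_iff.1 hΩ w hw
  have hmem : ∀ f : bergmanSubmodule Ω, ∃ g : ℂ → ℂ, DifferentiableOn ℂ g Ω ∧
      (f : Lp ℂ 2 (volume.restrict Ω)) =ᵐ[volume.restrict Ω] g := fun f => f.2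
  choose g hg hfg using hmem
  let ev : bergmanSubmodule Ω →ₗ[ℂ] ℂ :=
    { toFun := fun f => g f w
      map_add' := fun a b => by
        refine eqOn_of_ae_eq hΩ (hg (a + b)) ((hg a).add (hg b)) ?_ hw
        exact (hfg (a + b)).symm.trans
          ((Lp.coeFn_add (a : Lp ℂ 2 (volume.restrict Ω)) b).trans ((hfg a).add (hfg b)))
      map_smul' := fun c a => by
        refine eqOn_of_ae_eq hΩ (hg (c • a)) ((hg a).const_smul c) ?_ hw
        exact (hfg (c • a)).symm.trans
          ((Lp.coeFn_smul c (a : Lp ℂ 2 (volume.restrict Ω))).trans ((hfg a).const_smul c)) }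
  have hm := discMass_ne_zero hr
  have hbound : ∃ C : ℝ, ∀ f, ‖ev f‖ ≤ C * ‖f‖ := by
    have hmt := discMass_ne_top r
    have hmpos : 0 < (discMass r).toReal := ENNReal.toReal_pos hm hmt
    refine ⟨(Real.sqrt (discMass r).toReal)⁻¹, fun f => ?_⟩
    have h1 := enorm_sq_mul_discMass_le (hg f) hrΩ
    rw [← eLpNorm_congr_ae (hfg f), ← Lp.enorm_def] at h1
    have h3 := ENNReal.toReal_mono (by simp) h1
    simp only [ENNReal.toReal_mul, ENNReal.toReal_pow, toReal_enorm] at h3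
    rw [inv_mul_eq_div, le_div_iff₀ (by positivity)]
    refine le_of_sq_le_sq ?_ (norm_nonneg _)
    rw [mul_pow, Real.sq_sqrt hmpos.le]
    exact h3
  obtain ⟨C, hC⟩ := hbound
  have : CompleteSpace (bergmanSubmodule Ω) :=
    (isClosed_bergmanSubmodule hΩ).completeSpace_coe
  let L : bergmanSubmodule Ω →L[ℂ] ℂ := ev.mkContinuous C hC
  let k := (InnerProductSpace.toDual ℂ (bergmanSubmodule Ω)).symm L
  refine ⟨g k, ⟨hg k, (memLp_congr_ae (hfg k)).1 (Lp.memLp _)⟩, fun f hf => ?_⟩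
  have hfae := hf.2.coeFn_toLp
  let F : bergmanSubmodule Ω := ⟨hf.2.toLp f, f, hf.1, hfae⟩
  have h1 : f w = L F :=
    eqOn_of_ae_eq hΩ hf.1 (hg F) (hfae.symm.trans (hfg F)) hw
  have h2 : inner ℂ k F = L F := InnerProductSpace.toDual_symm_apply
  rw [h1, ← h2, Submodule.coe_inner, L2.inner_def]
  refine integral_congr_ae ?_
  filter_upwards [hfae, hfg k] with z hz1 hz2
  rw [hz2]
  change inner ℂ (g k z) (hf.2.toLp f z) = _
  rw [hz1, RCLike.inner_apply]

/-- On an open set the Bergman kernel has its defining property. -/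
theorem bergmanKernel_spec {Ω : Set ℂ} (hΩ : IsOpen Ω) {w : ℂ} (hw : w ∈ Ω) :
    IsReproducingAt Ω w fun z => bergmanKernel Ω z w := by
  have h := exists_isReproducingAt hΩ hw
  have e : (fun z => bergmanKernel Ω z w) = h.choose := by
    funext z
    simp only [bergmanKernel, dif_pos h]
  rw [e]
  exact h.choose_spec

/-- The representing function is unique on `Ω`. -/
theorem IsReproducingAt.eqOn {Ω : Set ℂ} (hΩ : IsOpen Ω) {w : ℂ} {k l : ℂ → ℂ}
    (hk : IsReproducingAt Ω w k) (hl : IsReproducingAt Ω w l) : Set.EqOn k l Ω := by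
  refine eqOn_of_ae_eq hΩ hk.1.1 hl.1.1 ?_
  have hd : MemBergman Ω (k - l) := ⟨hk.1.1.sub hl.1.1, hk.1.2.sub hl.1.2⟩
  have hint : ∀ m, MemBergman Ω m →
      Integrable (fun z => (k - l) z * conj (m z)) (volume.restrict Ω) := fun m hm =>
    MemLp.integrable_mul hd.2 hm.2.star
  have h0 : ∫ z in Ω, (k - l) z * conj ((k - l) z) = 0 := by
    have h1 := (hk.2 _ hd).symm.trans (hl.2 _ hd)
    rw [← sub_eq_zero, ← integral_sub (hint k hk.1) (hint l hl.1)] at h1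
    rw [← h1]
    refine integral_congr_ae (Filter.Eventually.of_forall fun z => ?_)
    simp only [Pi.sub_apply, map_sub]
    ring
  have hsq : Integrable (fun z => ‖(k - l) z‖ ^ 2) (volume.restrict Ω) :=
    (memLp_two_iff_integrable_sq_norm hd.2.aestronglyMeasurable).1 hd.2
  have h2 : ∫ z in Ω, ‖(k - l) z‖ ^ 2 = 0 := by
    have : (∫ z in Ω, ((‖(k - l) z‖ ^ 2 : ℝ) : ℂ)) = 0 := by
      rw [← h0]
      refine integral_congr_ae (Filter.Eventually.of_forall fun z => ?_)
      simp only [Complex.mul_conj, Complex.normSq_eq_norm_sq]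
    rw [integral_complex_ofReal] at this
    exact_mod_cast this
  rw [integral_eq_zero_iff_of_nonneg (fun z => by positivity) hsq] at h2
  filter_upwards [h2] with z hz
  exact sub_eq_zero.1 (by simpa using hz)

end

/-!
By Weyl's lemma `A²(Ω)` is the orthogonal complement of `∂ C_c^∞(Ω)` in `L²(Ω)`, so
`K = K_Ω(·, w)` differs from any `χ ∈ L²(Ω)` representing the evaluation at `w` by an element of
the closure of `∂ C_c^∞(Ω)`; here `χ` may be taken supported in a small disc around `w`. Let `η` be
a bounded weight with `|∇η| ≤ τ η / δ_Ω` for some `τ < h(Ω)`. For a test function `φ` put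
`P = ∂(ηφ)` and `Q = φ ∂η`, so that `η ∂φ = P - Q`. Hardy's inequality for `ηφ` gives
`‖Q‖ ≤ c ‖P‖` with `c = τ / h(Ω) < 1`. Testing `K` against `∂(η² φ) = η (P + Q)` then bounds
`‖η K‖` by a multiple of `‖η χ‖`, uniformly in `η`. Letting `η` approximate `δ_Ω ^ (-τ)` yields
`δ_Ω ^ (-τ) K ∈ L²(Ω)`. The mean value inequality upgrades this to the pointwise bound
`|K| ≤ C δ_Ω ^ (τ - 1)`, and for `τ = 1 - 2 / p` the two estimates together put `K` in `L^p(Ω)`.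
Hence `β(Ω) ≥ 2 / (1 - h(Ω))`, which is at least `6 / (3 - h(Ω))`.
-/

noncomputable section

/-! ### Wirtinger derivatives -/

/-- Twice the Wirtinger derivative `∂/∂z`; dropping the factor `1 / 2` makes `|dz u|` the length of
the gradient of `u` for real-valued `u`. -/
def dz (φ : ℂ → ℂ) (z : ℂ) : ℂ := fderiv ℝ φ z 1 - Complex.I * fderiv ℝ φ z Complex.I

/-- Twice the Wirtinger derivative `∂/∂z̄`, in the normalization of `dz`. -/
def dbar (φ : ℂ → ℂ) (z : ℂ) : ℂ := fderiv ℝ φ z 1 + Complex.I * fderiv ℝ φ z Complex.I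

section Wirtinger

variable {φ ψ : ℂ → ℂ} {z : ℂ}

theorem dz_add (hφ : DifferentiableAt ℝ φ z) (hψ : DifferentiableAt ℝ ψ z) :
    dz (φ + ψ) z = dz φ z + dz ψ z := by
  simp only [dz, fderiv_add hφ hψ, add_apply]
  ring

theorem dz_const_smul (c : ℂ) (hφ : DifferentiableAt ℝ φ z) : dz (c • φ) z = c * dz φ z := by
  simp only [dz, fderiv_const_smul hφ, smul_apply, smul_eq_mul]
  ring

theorem dz_mul (hφ : DifferentiableAt ℝ φ z) (hψ : DifferentiableAt ℝ ψ z) :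
    dz (fun z => φ z * ψ z) z = φ z * dz ψ z + ψ z * dz φ z := by
  simp only [dz, fderiv_fun_mul hφ hψ, add_apply, smul_apply, smul_eq_mul]
  ring

theorem dbar_mul (hφ : DifferentiableAt ℝ φ z) (hψ : DifferentiableAt ℝ ψ z) :
    dbar (fun z => φ z * ψ z) z = φ z * dbar ψ z + ψ z * dbar φ z := by
  simp only [dbar, fderiv_fun_mul hφ hψ, add_apply, smul_apply, smul_eq_mul]
  ring

theorem dbar_conj (hφ : DifferentiableAt ℝ φ z) :
    dbar (fun z => conj (φ z)) z = conj (dz φ z) := by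
  have h : HasFDerivAt (fun z => conj (φ z))
      ((Complex.conjCLE : ℂ →L[ℝ] ℂ).comp (fderiv ℝ φ z)) z :=
    (Complex.conjCLE : ℂ →L[ℝ] ℂ).hasFDerivAt.comp z hφ.hasFDerivAt
  simp [dz, dbar, h.fderiv]

theorem dbar_eq_zero (hφ : DifferentiableAt ℂ φ z) : dbar φ z = 0 := by
  have h := (differentiableAt_complex_iff_differentiableAt_real.1 hφ).2
  rw [dbar, h, smul_eq_mul, ← mul_assoc, Complex.I_mul_I]
  ring

theorem differentiableAt_of_dbar_eq_zero (hφ : DifferentiableAt ℝ φ z) (h : dbar φ z = 0) :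
    DifferentiableAt ℂ φ z := by
  refine differentiableAt_complex_iff_differentiableAt_real.2 ⟨hφ, ?_⟩
  rw [dbar] at h
  rw [smul_eq_mul]
  linear_combination (-Complex.I) * h + (fderiv ℝ φ z Complex.I) * Complex.I_mul_I

theorem support_dz_subset (φ : ℂ → ℂ) : Function.support (dz φ) ⊆ tsupport φ := fun z hz =>
  support_fderiv_subset ℝ fun h => hz (by simp [dz, h])

theorem support_dbar_subset (φ : ℂ → ℂ) : Function.support (dbar φ) ⊆ tsupport φ := fun z hz =>
  support_fderiv_subset ℝ fun h => hz (by simp [dbar, h])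

theorem norm_apply_one_sub_I_mul_apply_I (L : ℂ →L[ℝ] ℝ) :
    ‖(L 1 : ℂ) - Complex.I * L Complex.I‖ = ‖L‖ := by
  set D : ℂ := L 1 - Complex.I * L Complex.I with hD
  have hL : ∀ z, L z = (D * z).re := fun z => by
    conv_lhs => rw [← Complex.re_add_im z]
    have h : (z.re + z.im * Complex.I : ℂ) = z.re • (1 : ℂ) + z.im • Complex.I := by simp
    rw [h, map_add, map_smul, map_smul, hD]
    simp only [smul_eq_mul, Complex.mul_re, Complex.sub_re, Complex.ofReal_re, Complex.I_re,
      zero_mul, Complex.I_im, Complex.ofReal_im, mul_zero, sub_self, sub_zero, Complex.sub_im,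
      Complex.mul_im, one_mul, zero_add, zero_sub, neg_mul, sub_neg_eq_add]
    ring
  refine le_antisymm ?_ (L.opNorm_le_bound (norm_nonneg D) fun z => ?_)
  · have h : ‖D‖ * ‖D‖ ≤ ‖L‖ * ‖D‖ := by
      have h1 := L.le_opNorm (conj D)
      rw [hL, Complex.mul_conj, Complex.ofReal_re, Complex.normSq_eq_norm_sq, RCLike.norm_conj,
        Real.norm_of_nonneg (sq_nonneg _)] at h1
      linarith
    rcases (norm_nonneg D).eq_or_lt with h0 | h0
    · exact h0 ▸ norm_nonneg L
    · exact le_of_mul_le_mul_right h h0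
  · rw [hL, ← norm_mul]
    exact Complex.abs_re_le_norm _

theorem dz_ofReal {u : ℂ → ℝ} (hu : DifferentiableAt ℝ u z) :
    dz (fun z => (u z : ℂ)) z = fderiv ℝ u z 1 - Complex.I * fderiv ℝ u z Complex.I := by
  have h : HasFDerivAt (fun z => (u z : ℂ)) (Complex.ofRealCLM.comp (fderiv ℝ u z)) z :=
    Complex.ofRealCLM.hasFDerivAt.comp z hu.hasFDerivAt
  simp [dz, h.fderiv]

theorem norm_dz_ofReal {u : ℂ → ℝ} (hu : DifferentiableAt ℝ u z) :
    ‖dz (fun z => (u z : ℂ)) z‖ = ‖fderiv ℝ u z‖ := by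
  rw [dz_ofReal hu, norm_apply_one_sub_I_mul_apply_I]

end Wirtinger

/-! ### Complex test functions -/

/-- The complex-valued counterpart of `IsTestFunction`. -/
structure IsComplexTest (Ω : Set ℂ) (φ : ℂ → ℂ) : Prop where
  contDiff : ContDiff ℝ ∞ φ
  hasCompactSupport : HasCompactSupport φ
  tsupport_subset : tsupport φ ⊆ Ω

namespace IsComplexTest

variable {Ω : Set ℂ} {φ ψ : ℂ → ℂ}

theorem differentiable (h : IsComplexTest Ω φ) : Differentiable ℝ φ :=
  h.contDiff.differentiable (by simp)

theorem mono {Ω' : Set ℂ} (h : IsComplexTest Ω φ) (hΩ : Ω ⊆ Ω') : IsComplexTest Ω' φ :=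
  ⟨h.contDiff, h.hasCompactSupport, h.tsupport_subset.trans hΩ⟩

theorem zero (Ω : Set ℂ) : IsComplexTest Ω 0 :=
  ⟨contDiff_const, HasCompactSupport.zero, by simp [tsupport]⟩

theorem add (h : IsComplexTest Ω φ) (h' : IsComplexTest Ω ψ) : IsComplexTest Ω (φ + ψ) :=
  ⟨h.contDiff.add h'.contDiff, h.hasCompactSupport.add h'.hasCompactSupport,
    (tsupport_add φ ψ).trans (Set.union_subset h.tsupport_subset h'.tsupport_subset)⟩

theorem star (h : IsComplexTest Ω φ) : IsComplexTest Ω fun z => conj (φ z) where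
  contDiff := Complex.conjCLE.contDiff.comp h.contDiff
  hasCompactSupport := h.hasCompactSupport.comp_left (map_zero _)
  tsupport_subset := (closure_mono
    (Function.support_comp_subset (map_zero (starRingEnd ℂ)) φ)).trans h.tsupport_subset

theorem mul_left (h : IsComplexTest Ω φ) (hΩ : IsOpen Ω) {η : ℂ → ℂ} (hη : ContDiffOn ℝ ∞ η Ω) :
    IsComplexTest Ω fun z => η z * φ z where
  contDiff := contDiff_iff_contDiffAt.2 fun z => by
    by_cases hz : z ∈ tsupport φ
    · exact (hη.contDiffAt (hΩ.mem_nhds (h.tsupport_subset hz))).mul h.contDiff.contDiffAt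
    · refine contDiffAt_const (c := (0 : ℂ)) |>.congr_of_eventuallyEq ?_
      filter_upwards [(isClosed_tsupport φ).isOpen_compl.mem_nhds hz] with x hx
      rw [image_eq_zero_of_notMem_tsupport hx, mul_zero]
  hasCompactSupport := h.hasCompactSupport.mul_left
  tsupport_subset :=
    (closure_mono (Function.support_mul_subset_right _ _)).trans h.tsupport_subset

theorem const_smul (h : IsComplexTest Ω φ) (c : ℂ) : IsComplexTest Ω (c • φ) where
  contDiff := h.contDiff.const_smul c
  hasCompactSupport := h.hasCompactSupport.smul_left (f := fun _ => c)
  tsupport_subset :=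
    (closure_mono (Function.support_const_smul_subset c φ)).trans h.tsupport_subset

theorem continuous_fderiv_apply (h : IsComplexTest Ω φ) (v : ℂ) :
    Continuous fun z => fderiv ℝ φ z v :=
  (h.contDiff.continuous_fderiv (by simp)).clm_apply continuous_const

theorem integrable_fderiv_apply (h : IsComplexTest Ω φ) (v : ℂ) :
    Integrable fun z => fderiv ℝ φ z v :=
  (h.continuous_fderiv_apply v).integrable_of_hasCompactSupport
    (h.hasCompactSupport.fderiv_apply ℝ v)

theorem continuous_dz (h : IsComplexTest Ω φ) : Continuous (dz φ) :=
  (h.continuous_fderiv_apply 1).sub (continuous_const.mul (h.continuous_fderiv_apply _))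

theorem hasCompactSupport_dz (h : IsComplexTest Ω φ) : HasCompactSupport (dz φ) :=
  h.hasCompactSupport.mono' (support_dz_subset φ)

theorem memLp_dz (h : IsComplexTest Ω φ) (μ : Measure ℂ) [IsFiniteMeasureOnCompacts μ] :
    MemLp (dz φ) 2 μ :=
  h.continuous_dz.memLp_of_hasCompactSupport h.hasCompactSupport_dz

end IsComplexTest

theorem integral_fderiv_apply_eq_zero {E 𝕜 : Type*} [NormedAddCommGroup E] [NormedSpace ℝ E]
    [FiniteDimensional ℝ E] [MeasurableSpace E] [BorelSpace E] [NormedField 𝕜] [NormedAlgebra ℝ 𝕜]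
    {μ : Measure E} [μ.IsAddHaarMeasure] {f : E → 𝕜} (hf : ContDiff ℝ 1 f)
    (hc : HasCompactSupport f) (v : E) : ∫ x, fderiv ℝ f x v ∂μ = 0 := by
  have hf' : Continuous fun x => fderiv ℝ f x v :=
    (hf.continuous_fderiv one_ne_zero).clm_apply continuous_const
  have h := integral_mul_fderiv_eq_neg_fderiv_mul_of_integrable (μ := μ) (v := v)
    (f := fun _ : E => (1 : 𝕜)) (g := f) (by simp)
    (by simpa using hf'.integrable_of_hasCompactSupport (hc.fderiv_apply ℝ v))
    (by simpa using hf.continuous.integrable_of_hasCompactSupport hc)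
    (fun _ _ => differentiableAt_const _) (fun x _ => hf.differentiable one_ne_zero x)
  simpa using h

theorem IsComplexTest.integral_dbar {Ω : Set ℂ} {φ : ℂ → ℂ} (hφ : IsComplexTest Ω φ) :
    ∫ z, dbar φ z = 0 := by
  have h := fun v => integral_fderiv_apply_eq_zero (μ := volume)
    (hφ.contDiff.of_le (by simp)) hφ.hasCompactSupport v
  simp only [dbar]
  rw [integral_add (hφ.integrable_fderiv_apply 1) ((hφ.integrable_fderiv_apply _).const_mul _),
    integral_const_mul, h, h, mul_zero, add_zero]

theorem setIntegral_mul_conj_dz_eq_zero {Ω : Set ℂ} (hΩ : IsOpen Ω) {k φ : ℂ → ℂ}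
    (hk : DifferentiableOn ℂ k Ω) (hφ : IsComplexTest Ω φ) :
    ∫ z in Ω, k z * conj (dz φ z) = 0 := by
  have hψ : IsComplexTest Ω fun z => k z * conj (φ z) :=
    hφ.star.mul_left hΩ ((hk.contDiffOn hΩ).restrict_scalars ℝ)
  rw [← hψ.integral_dbar, ← setIntegral_eq_integral_of_forall_compl_eq_zero (s := Ω) fun z hz =>
    Function.notMem_support.1 fun h => hz (hψ.tsupport_subset (support_dbar_subset _ h))]
  refine setIntegral_congr_fun hΩ.measurableSet fun z hz => ?_
  have hkz := hk.differentiableAt (hΩ.mem_nhds hz)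
  simp only [dbar_mul (hkz.restrictScalars ℝ) (hφ.star.differentiable z), dbar_eq_zero hkz,
    dbar_conj (hφ.differentiable z), mul_zero, add_zero]

/-! ### Weyl's lemma for the Cauchy-Riemann operator -/

theorem unifIntegrable_of_ae_norm_le {α ι E : Type*} {m : MeasurableSpace α} {μ : Measure α}
    [NormedAddCommGroup E] {p : ℝ≥0∞} (hp : 1 ≤ p) (hp' : p ≠ ⊤) {u : ι → α → E} {M : ℝ}
    (hu : ∀ i, AEStronglyMeasurable (u i) μ) (hM : ∀ i, ∀ᵐ x ∂μ, ‖u i x‖ ≤ M) :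
    UnifIntegrable u p μ := by
  refine unifIntegrable_of hp hp' hu fun ε _ => ⟨M.toNNReal + 1, fun i => ?_⟩
  have h : {x | M.toNNReal + 1 ≤ ‖u i x‖₊}.indicator (u i) =ᵐ[μ] 0 := by
    filter_upwards [hM i] with x hx
    refine Set.indicator_of_notMem (fun hxM => ?_) _
    have h1 : ((M.toNNReal + 1 : ℝ≥0) : ℝ) ≤ ‖u i x‖ := Set.mem_ofPred.1 hxM
    push_cast at h1
    linarith [Real.le_coe_toNNReal M]
  simp [eLpNorm_congr_ae h]

theorem exists_differentiableOn_of_tendsto_ae {Ω : Set ℂ} (hΩ : IsOpen Ω) (hvol : volume Ω ≠ ⊤)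
    {M : ℝ} {u : ℕ → ℂ → ℂ} {f : ℂ → ℂ} (hu : ∀ n, DifferentiableOn ℂ (u n) Ω)
    (hM : ∀ n, ∀ z ∈ Ω, ‖u n z‖ ≤ M)
    (hf : ∀ᵐ z ∂volume.restrict Ω, Filter.Tendsto (fun n => u n z) Filter.atTop (nhds (f z))) :
    ∃ g, DifferentiableOn ℂ g Ω ∧ f =ᵐ[volume.restrict Ω] g := by
  have : IsFiniteMeasure (volume.restrict Ω) := isFiniteMeasure_restrict.2 hvol
  have hmeas : ∀ n, AEStronglyMeasurable (u n) (volume.restrict Ω) := fun n =>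
    (hu n).continuousOn.aestronglyMeasurable hΩ.measurableSet
  have hbd : ∀ n, ∀ᵐ z ∂volume.restrict Ω, ‖u n z‖ ≤ M := fun n =>
    ae_restrict_of_forall_mem hΩ.measurableSet (hM n)
  have hmem : ∀ n, MemLp (u n) 2 (volume.restrict Ω) := fun n => .of_bound (hmeas n) M (hbd n)
  have hfm : MemLp f 2 (volume.restrict Ω) := by
    refine .of_bound (aestronglyMeasurable_of_tendsto_ae _ hmeas hf) M ?_
    filter_upwards [hf, ae_all_iff.2 hbd] with z h1 h2
    exact le_of_tendsto h1.norm (.of_forall h2)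
  have htend := tendsto_Lp_finite_of_tendsto_ae one_le_two ENNReal.ofNat_ne_top hmeas hfm
    (unifIntegrable_of_ae_norm_le one_le_two ENNReal.ofNat_ne_top hmeas hbd) hf
  rw [← Lp.tendsto_Lp_iff_tendsto_eLpNorm'' u hmem f hfm] at htend
  obtain ⟨g, hg, hfg⟩ := (isClosed_bergmanSubmodule hΩ).mem_of_tendsto htend
    (.of_forall fun n => ⟨u n, hu n, (hmem n).coeFn_toLp⟩)
  exact ⟨g, hg, hfm.coeFn_toLp.symm.trans hfg⟩

section Mollification

open scoped Convolution
open ContinuousLinearMap (lsmul)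

theorem lintegral_enorm_convolution_le {G E : Type*} [AddGroup G] [MeasurableSpace G]
    [MeasurableAdd₂ G] [MeasurableNeg G] {μ : Measure G} [SFinite μ] [μ.IsAddRightInvariant]
    [NormedAddCommGroup E] [NormedSpace ℝ E] {ρ : G → ℝ} {F : G → E}
    (hρ : AEStronglyMeasurable ρ μ) (hF : AEStronglyMeasurable F μ) :
    ∫⁻ x, ‖(ρ ⋆[lsmul ℝ ℝ, μ] F) x‖ₑ ∂μ ≤ (∫⁻ t, ‖ρ t‖ₑ ∂μ) * ∫⁻ x, ‖F x‖ₑ ∂μ := by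
  have hm : AEMeasurable (Function.uncurry fun x t => ‖ρ t‖ₑ * ‖F (x - t)‖ₑ) (μ.prod μ) :=
    hρ.enorm.comp_snd.mul (hF.comp_quasiMeasurePreserving
      (quasiMeasurePreserving_sub_of_right_invariant μ μ)).enorm
  calc ∫⁻ x, ‖(ρ ⋆[lsmul ℝ ℝ, μ] F) x‖ₑ ∂μ
      ≤ ∫⁻ x, ∫⁻ t, ‖ρ t‖ₑ * ‖F (x - t)‖ₑ ∂μ ∂μ := lintegral_mono fun x =>
        (enorm_integral_le_lintegral_enorm _).trans_eq <| by
          simp only [ContinuousLinearMap.lsmul_apply, enorm_smul]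
    _ = ∫⁻ t, ‖ρ t‖ₑ * ∫⁻ x, ‖F x‖ₑ ∂μ ∂μ := by
        rw [lintegral_lintegral_swap hm]
        refine lintegral_congr fun t => ?_
        rw [lintegral_const_mul' _ _ enorm_ne_top, lintegral_sub_right_eq_self (fun x => ‖F x‖ₑ) t]
    _ = (∫⁻ t, ‖ρ t‖ₑ ∂μ) * ∫⁻ x, ‖F x‖ₑ ∂μ := lintegral_mul_const'' _ hρ.enorm

theorem lintegral_enorm_normed_convolution_le {G E : Type*} [NormedAddCommGroup G]
    [NormedSpace ℝ G] [FiniteDimensional ℝ G] [MeasurableSpace G] [BorelSpace G] {μ : Measure G}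
    [μ.IsAddHaarMeasure] [NormedAddCommGroup E] [NormedSpace ℝ E] (φ : ContDiffBump (0 : G))
    {F : G → E} (hF : AEStronglyMeasurable F μ) :
    ∫⁻ x, ‖(φ.normed μ ⋆[lsmul ℝ ℝ, μ] F) x‖ₑ ∂μ ≤ ∫⁻ x, ‖F x‖ₑ ∂μ := by
  have h : ∫⁻ t, ‖φ.normed μ t‖ₑ ∂μ = 1 := by
    rw [← ofReal_integral_norm_eq_lintegral_enorm φ.integrable_normed]
    simp_rw [Real.norm_of_nonneg (φ.nonneg_normed _)]
    rw [φ.integral_normed, ENNReal.ofReal_one]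
  simpa [h] using
    lintegral_enorm_convolution_le (φ.continuous_normed (μ := μ)).aestronglyMeasurable hF

theorem fderiv_convolution_apply {ρ : ℂ → ℝ} (hρ : ContDiff ℝ 1 ρ) (hc : HasCompactSupport ρ)
    {F : ℂ → ℂ} (hF : LocallyIntegrable F) (x v : ℂ) :
    fderiv ℝ (ρ ⋆[lsmul ℝ ℝ] F) x v = -∫ t, F t * fderiv ℝ (fun t => (ρ (x - t) : ℂ)) t v := by
  have hd := hc.hasFDerivAt_convolution_right (lsmul ℝ ℝ : ℝ →L[ℝ] ℂ →L[ℝ] ℂ).flip hF hρ x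
  have hρx : ∀ t, fderiv ℝ (fun t => (ρ (x - t) : ℂ)) t v = -(fderiv ℝ ρ (x - t) v : ℂ) := by
    intro t
    have h : HasFDerivAt (fun t => (ρ (x - t) : ℂ)) _ t := Complex.ofRealCLM.hasFDerivAt.comp t
      ((hρ.differentiable one_ne_zero (x - t)).hasFDerivAt.comp t ((hasFDerivAt_id t).const_sub x))
    simp [h.fderiv]
  rw [← convolution_flip, hd.fderiv, convolution_precompR_apply _ hF (hc.fderiv ℝ)
    (hρ.continuous_fderiv one_ne_zero), convolution_def, ← integral_neg]
  refine integral_congr_ae (.of_forall fun t => ?_)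
  simp only [hρx, ContinuousLinearMap.flip_apply, ContinuousLinearMap.lsmul_apply,
    Complex.real_smul]
  ring

theorem isComplexTest_normed_sub (φ : ContDiffBump (0 : ℂ)) {x w : ℂ} {R : ℝ}
    (hx : dist x w + φ.rOut < R) :
    IsComplexTest (ball w R) fun t => (φ.normed volume (x - t) : ℂ) := by
  have hsupp : tsupport (fun t => (φ.normed volume (x - t) : ℂ)) ⊆ closedBall x φ.rOut := by
    refine closure_minimal (fun t ht => ?_) isClosed_closedBall
    have h : x - t ∈ Function.support (φ.normed volume) := fun h => ht (by simp [h])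
    rw [φ.support_normed_eq, mem_ball_zero_iff] at h
    rw [mem_closedBall, dist_comm, dist_eq_norm]
    exact h.le
  exact ⟨Complex.ofRealCLM.contDiff.comp (φ.contDiff_normed.comp (contDiff_const.sub contDiff_id)),
    (isCompact_closedBall x φ.rOut).of_isClosed_subset (isClosed_tsupport _) hsupp,
    hsupp.trans (closedBall_subset_ball' (by linarith))⟩

theorem differentiableAt_convolution_of_weak {w x : ℂ} {R : ℝ} {F : ℂ → ℂ}
    (hF : LocallyIntegrable F)
    (hweak : ∀ ψ, IsComplexTest (ball w R) ψ → ∫ z, F z * dbar ψ z = 0)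
    (φ : ContDiffBump (0 : ℂ)) (hx : dist x w + φ.rOut < R) :
    DifferentiableAt ℂ (φ.normed volume ⋆[lsmul ℝ ℝ] F) x := by
  have hρ : ContDiff ℝ 1 (φ.normed volume) := φ.contDiff_normed
  have hc : HasCompactSupport (φ.normed volume) := φ.hasCompactSupport_normed
  refine differentiableAt_of_dbar_eq_zero
    (hc.hasFDerivAt_convolution_left _ hρ hF x).differentiableAt ?_
  have hψ := isComplexTest_normed_sub φ hx
  have hint : ∀ v, Integrable fun t =>
      F t * fderiv ℝ (fun t => (φ.normed volume (x - t) : ℂ)) t v := fun v => by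
    simpa only [smul_eq_mul, mul_comm] using hF.integrable_smul_left_of_hasCompactSupport
      (hψ.continuous_fderiv_apply v) (hψ.hasCompactSupport.fderiv_apply ℝ v)
  have h0 := hweak _ hψ
  simp only [dbar, mul_add, mul_left_comm _ Complex.I] at h0
  rw [integral_add (hint 1) ((hint _).const_mul _), integral_const_mul] at h0
  rw [dbar, fderiv_convolution_apply hρ hc hF, fderiv_convolution_apply hρ hc hF]
  linear_combination -h0

theorem exists_differentiableOn_ball_of_weak {w : ℂ} {r : ℝ} (hr : 0 < r) {F : ℂ → ℂ}
    (hF : Integrable F)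
    (hweak : ∀ ψ, IsComplexTest (ball w (3 * r)) ψ → ∫ z, F z * dbar ψ z = 0) :
    ∃ g, DifferentiableOn ℂ g (ball w r) ∧ F =ᵐ[volume.restrict (ball w r)] g := by
  let φ : ℕ → ContDiffBump (0 : ℂ) := fun n =>
    ⟨r / (2 * (n + 1)), r / (n + 1), by positivity, by gcongr; linarith⟩
  have hφle : ∀ n, (φ n).rOut ≤ r := fun n =>
    div_le_self hr.le (by linarith [n.cast_nonneg (α := ℝ)])
  let u : ℕ → ℂ → ℂ := fun n => (φ n).normed volume ⋆[lsmul ℝ ℝ] F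
  have hu : ∀ n, DifferentiableOn ℂ (u n) (ball w (2 * r)) := fun n x hx =>
    (differentiableAt_convolution_of_weak hF.locallyIntegrable hweak (φ n)
      (by linarith [hφle n, mem_ball.1 hx])).differentiableWithinAt
  have hlim : ∀ᵐ x, Filter.Tendsto (fun n => u n x) Filter.atTop (nhds (F x)) := by
    refine ContDiffBump.ae_convolution_tendsto_right_of_locallyIntegrable (K := 2) ?_
      (.of_forall fun n => ?_) hF.locallyIntegrable
    · simpa only [Nat.cast_add_one] using (Filter.tendsto_add_atTop_iff_nat 1).2
        (tendsto_const_div_atTop_nhds_zero_nat r)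
    · change r / (n + 1) ≤ 2 * (r / (2 * (n + 1)))
      apply le_of_eq
      field_simp
  have hbd : ∀ n, ∀ z ∈ ball w r, ‖u n z‖ ≤ ((∫⁻ x, ‖F x‖ₑ) / discMass r).toReal := by
    intro n z hz
    have hsub : ball z r ⊆ ball w (2 * r) := ball_subset_ball' (by linarith [mem_ball.1 hz])
    have h := (enorm_mul_discMass_le ((hu n).mono hsub)).trans
      ((setLIntegral_le_lintegral _ _).trans (lintegral_enorm_normed_convolution_le (φ n) hF.1))
    rw [← toReal_enorm]
    refine ENNReal.toReal_mono (ENNReal.div_ne_top hF.2.ne (discMass_ne_zero hr)) ?_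
    rwa [ENNReal.le_div_iff_mul_le (.inl (discMass_ne_zero hr)) (.inl (discMass_ne_top r))]
  exact exists_differentiableOn_of_tendsto_ae isOpen_ball measure_ball_lt_top.ne
    (fun n => (hu n).mono (ball_subset_ball (by linarith))) hbd (ae_restrict_of_ae hlim)

end Mollification

theorem exists_differentiableOn_of_locally {Ω : Set ℂ} {f : ℂ → ℂ}
    (h : ∀ w ∈ Ω, ∃ r > 0, ball w r ⊆ Ω ∧ ∃ g, DifferentiableOn ℂ g (ball w r) ∧
      f =ᵐ[volume.restrict (ball w r)] g) :
    ∃ g, DifferentiableOn ℂ g Ω ∧ f =ᵐ[volume.restrict Ω] g := by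
  choose! r hr hrΩ g hg hfg using h
  have hcompat : ∀ w ∈ Ω, ∀ z ∈ ball w (r w), g z z = g w z := by
    intro w hw z hz
    have hzΩ := hrΩ w hw hz
    refine eqOn_of_ae_eq (isOpen_ball.inter isOpen_ball) ((hg z hzΩ).mono Set.inter_subset_left)
      ((hg w hw).mono Set.inter_subset_right) ?_ ⟨mem_ball_self (hr z hzΩ), hz⟩
    filter_upwards [ae_restrict_of_ae_restrict_of_subset Set.inter_subset_left (hfg z hzΩ),
      ae_restrict_of_ae_restrict_of_subset Set.inter_subset_right (hfg w hw)] with x h1 h2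
    rw [← h1, h2]
  have hball : ∀ w ∈ Ω, ball w (r w) ∈ nhds w := fun w hw => ball_mem_nhds w (hr w hw)
  refine ⟨fun z => g z z, fun w hw => ?_, ?_⟩
  · refine (((hg w hw).differentiableAt (hball w hw)).congr_of_eventuallyEq
      ?_).differentiableWithinAt
    filter_upwards [hball w hw] with z hz using hcompat w hw z hz
  · obtain ⟨T, hTΩ, hT, hcover⟩ := TopologicalSpace.countable_cover_nhdsWithin
      fun w hw => mem_nhdsWithin_of_mem_nhds (hball w hw)
    refine ae_restrict_of_ae_restrict_of_subset hcover
      ((ae_restrict_biUnion_iff _ hT _).2 fun w hw => ?_)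
    filter_upwards [hfg w (hTΩ hw), ae_restrict_mem measurableSet_ball] with z h1 h2
    rw [h1, hcompat w (hTΩ hw) z h2]

theorem exists_differentiableOn_of_weak {Ω : Set ℂ} (hΩ : IsOpen Ω) {f : ℂ → ℂ}
    (hf : LocallyIntegrableOn f Ω)
    (hweak : ∀ ψ, IsComplexTest Ω ψ → ∫ z in Ω, f z * dbar ψ z = 0) :
    ∃ g, DifferentiableOn ℂ g Ω ∧ f =ᵐ[volume.restrict Ω] g := by
  refine exists_differentiableOn_of_locally fun w hw => ?_
  obtain ⟨R, hR, hRΩ⟩ := nhds_basis_closedBall.mem_iff.1 (hΩ.mem_nhds hw)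
  have hsub : ball w (R / 3) ⊆ closedBall w R :=
    ball_subset_closedBall.trans (closedBall_subset_closedBall (by linarith))
  have hint : IntegrableOn f (closedBall w R) :=
    hf.integrableOn_compact_subset hRΩ (isCompact_closedBall w R)
  obtain ⟨g, hg, hfg⟩ := exists_differentiableOn_ball_of_weak (w := w) (by positivity : 0 < R / 3)
    ((integrable_indicator_iff measurableSet_closedBall).2 hint) fun ψ hψ => by
      rw [mul_div_cancel₀ R three_ne_zero] at hψ
      rw [← hweak ψ (hψ.mono (ball_subset_closedBall.trans hRΩ)),
        ← integral_indicator hΩ.measurableSet]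
      refine integral_congr_ae (.of_forall fun z => ?_)
      by_cases hz : z ∈ closedBall w R
      · simp [hz, hRΩ hz]
      · have : dbar ψ z = 0 := Function.notMem_support.1 fun h =>
          hz (ball_subset_closedBall (hψ.tsupport_subset (support_dbar_subset ψ h)))
        simp [this, Set.indicator]
  refine ⟨R / 3, by positivity, hsub.trans hRΩ, g, hg, ?_⟩
  filter_upwards [hfg, ae_restrict_mem measurableSet_ball] with z h1 h2
  rwa [Set.indicator_of_mem (hsub h2)] at h1

/-! ### The orthogonal complement of the Bergman space -/

/-- The space `∂ C_c^∞(Ω)` of Wirtinger derivatives of test functions, inside `L²(Ω)`. It is dense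
in the orthogonal complement of the Bergman space. -/
def dzRange (Ω : Set ℂ) : Submodule ℂ (Lp ℂ 2 (volume.restrict Ω)) where
  carrier := {F | ∃ φ, IsComplexTest Ω φ ∧ F =ᵐ[volume.restrict Ω] dz φ}
  add_mem' := by
    rintro a b ⟨φ, hφ, ha⟩ ⟨ψ, hψ, hb⟩
    refine ⟨φ + ψ, hφ.add hψ, (Lp.coeFn_add a b).trans ?_⟩
    filter_upwards [ha, hb] with z h1 h2
    rw [dz_add (hφ.differentiable z) (hψ.differentiable z), Pi.add_apply, h1, h2]
  zero_mem' := by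
    refine ⟨0, .zero Ω, (Lp.coeFn_zero _ _ _).trans (.of_forall fun z => ?_)⟩
    simp [dz]
  smul_mem' := by
    rintro c a ⟨φ, hφ, ha⟩
    refine ⟨c • φ, hφ.const_smul c, (Lp.coeFn_smul c a).trans ?_⟩
    filter_upwards [ha] with z h
    rw [dz_const_smul c (hφ.differentiable z), Pi.smul_apply, h, smul_eq_mul]

theorem inner_eq_integral_mul_conj {α : Type*} {m : MeasurableSpace α} {μ : Measure α}
    {F G : Lp ℂ 2 μ} {f g : α → ℂ} (hf : F =ᵐ[μ] f) (hg : G =ᵐ[μ] g) :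
    inner ℂ F G = ∫ x, g x * conj (f x) ∂μ := by
  rw [L2.inner_def]
  refine integral_congr_ae ?_
  filter_upwards [hf, hg] with x h1 h2
  rw [RCLike.inner_apply, h1, h2]

theorem exists_memBergman_of_mem_dzRange_orthogonal {Ω : Set ℂ} (hΩ : IsOpen Ω)
    {F : Lp ℂ 2 (volume.restrict Ω)} (hF : F ∈ (dzRange Ω)ᗮ) :
    ∃ g, MemBergman Ω g ∧ F =ᵐ[volume.restrict Ω] g := by
  have hloc : LocallyIntegrableOn F Ω :=
    locallyIntegrableOn_of_locallyIntegrable_restrict ((Lp.memLp F).locallyIntegrable one_le_two)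
  obtain ⟨g, hg, hFg⟩ := exists_differentiableOn_of_weak hΩ hloc fun ψ hψ => by
    have hmem := hψ.star.memLp_dz (volume.restrict Ω)
    have h := (Submodule.mem_orthogonal _ _).1 hF (hmem.toLp _) ⟨_, hψ.star, hmem.coeFn_toLp⟩
    simpa only [inner_eq_integral_mul_conj hmem.coeFn_toLp (Filter.EventuallyEq.refl _ _),
      ← dbar_conj (hψ.star.differentiable _), Complex.conj_conj] using h
  exact ⟨g, ⟨hg, (memLp_congr_ae hFg).1 (Lp.memLp F)⟩, hFg⟩

theorem exists_tendsto_eLpNorm_sub_dz {Ω : Set ℂ} (hΩ : IsOpen Ω) {f : ℂ → ℂ}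
    (hf : MemLp f 2 (volume.restrict Ω))
    (horth : ∀ g, MemBergman Ω g → ∫ z in Ω, g z * conj (f z) = 0) :
    ∃ φ : ℕ → ℂ → ℂ, (∀ n, IsComplexTest Ω (φ n)) ∧
      Filter.Tendsto (fun n => eLpNorm (f - dz (φ n)) 2 (volume.restrict Ω)) Filter.atTop
        (nhds 0) := by
  have hmem : hf.toLp f ∈ closure (dzRange Ω : Set (Lp ℂ 2 (volume.restrict Ω))) := by
    rw [← Submodule.topologicalClosure_coe, ← Submodule.orthogonal_orthogonal_eq_closure]
    refine (Submodule.mem_orthogonal _ _).2 fun F hF => ?_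
    obtain ⟨g, hg, hFg⟩ := exists_memBergman_of_mem_dzRange_orthogonal hΩ hF
    rw [← inner_conj_symm, inner_eq_integral_mul_conj hf.coeFn_toLp hFg, horth g hg, map_zero]
  obtain ⟨F, hF, hlim⟩ := mem_closure_iff_seq_limit.1 hmem
  choose φ hφ hFφ using hF
  refine ⟨φ, hφ, (tendsto_iff_edist_tendsto_0.1 hlim).congr fun n => ?_⟩
  rw [edist_comm, Lp.edist_def]
  exact eLpNorm_congr_ae (hf.coeFn_toLp.sub (hFφ n))

/-! ### Hardy's inequality for complex test functions -/

theorem IsTestFunction.hardyConstant_sq_mul_lintegral_le {Ω : Set ℂ} {φ : ℂ → ℝ}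
    (hφ : IsTestFunction Ω φ) :
    hardyConstant Ω ^ 2 * ∫⁻ z in Ω, ‖φ z‖ₑ ^ 2 / boundaryDist Ω z ^ 2 ≤
      ∫⁻ z in Ω, ‖fderiv ℝ φ z‖ₑ ^ 2 := by
  by_cases h0 : φ = 0
  · simp [h0]
  refine ENNReal.mul_le_of_le_div ?_
  calc hardyConstant Ω ^ 2
      = ⨅ (φ : ℂ → ℝ) (_ : IsTestFunction Ω φ ∧ φ ≠ 0), hardyQuotient Ω φ := by
        rw [hardyConstant, ← ENNReal.rpow_natCast, ← ENNReal.rpow_mul]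
        norm_num
    _ ≤ hardyQuotient Ω φ := iInf₂_le φ ⟨hφ, h0⟩

theorem fderiv_fderiv_apply_comm {E F : Type*} [NormedAddCommGroup E] [NormedSpace ℝ E]
    [NormedAddCommGroup F] [NormedSpace ℝ F] {v : E → F} (hv : ContDiff ℝ 2 v) (x a b : E) :
    fderiv ℝ (fun x => fderiv ℝ v x a) x b = fderiv ℝ (fun x => fderiv ℝ v x b) x a := by
  have hd : DifferentiableAt ℝ (fderiv ℝ v) x :=
    (hv.fderiv_right (m := 1) (by norm_num)).differentiable one_ne_zero x
  have hs : IsSymmSndFDerivAt ℝ v x := hv.contDiffAt.isSymmSndFDerivAt (by simp)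
  rw [fderiv_clm_apply hd (differentiableAt_const _),
    fderiv_clm_apply hd (differentiableAt_const _)]
  simpa using hs b a

theorem integrable_fderiv_apply_mul_fderiv_apply {E : Type*} [NormedAddCommGroup E]
    [NormedSpace ℝ E] [MeasurableSpace E] [OpensMeasurableSpace E] {μ : Measure E}
    [IsFiniteMeasureOnCompacts μ] {u v : E → ℝ} (hu : ContDiff ℝ 1 u) (hc : HasCompactSupport u)
    (hv : ContDiff ℝ 1 v) (a b : E) :
    Integrable (fun x => fderiv ℝ u x a * fderiv ℝ v x b) μ :=
  (((hu.continuous_fderiv one_ne_zero).clm_apply continuous_const).mul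
    ((hv.continuous_fderiv one_ne_zero).clm_apply continuous_const)).integrable_of_hasCompactSupport
      (hc.fderiv_apply ℝ a).mul_right

theorem integral_fderiv_mul_fderiv_comm {E : Type*} [NormedAddCommGroup E] [NormedSpace ℝ E]
    [FiniteDimensional ℝ E] [MeasurableSpace E] [BorelSpace E] {μ : Measure E}
    [μ.IsAddHaarMeasure] {u v : E → ℝ} (hu : ContDiff ℝ 1 u) (hc : HasCompactSupport u)
    (hv : ContDiff ℝ 2 v) (a b : E) :
    ∫ x, fderiv ℝ u x a * fderiv ℝ v x b ∂μ = ∫ x, fderiv ℝ u x b * fderiv ℝ v x a ∂μ := by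
  have hv' : ∀ w, ContDiff ℝ 1 fun x => fderiv ℝ v x w := fun w =>
    (hv.fderiv_right (m := 1) (by norm_num)).clm_apply contDiff_const
  have hint : ∀ g : E → ℝ, Continuous g → Integrable (fun x => u x * g x) μ := fun g hg =>
    (hu.continuous.mul hg).integrable_of_hasCompactSupport hc.mul_right
  have ibp : ∀ a b, ∫ x, u x * fderiv ℝ (fun x => fderiv ℝ v x a) x b ∂μ =
      -∫ x, fderiv ℝ u x b * fderiv ℝ v x a ∂μ := fun a b =>
    integral_mul_fderiv_eq_neg_fderiv_mul_of_integrable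
      (integrable_fderiv_apply_mul_fderiv_apply hu hc (hv.of_le one_le_two) b a)
      (hint _ (((hv' a).continuous_fderiv one_ne_zero).clm_apply continuous_const))
      (hint _ (hv' a).continuous)
      (fun x _ => hu.differentiable one_ne_zero x)
      (fun x _ => (hv' a).differentiable one_ne_zero x)
  have h := ibp b a
  simp_rw [fderiv_fderiv_apply_comm hv _ b a, ibp a b, neg_inj] at h
  exact h.symm

theorem IsTestFunction.integrable_norm_fderiv_sq {Ω : Set ℂ} {u : ℂ → ℝ}
    (hu : IsTestFunction Ω u) : Integrable fun z => ‖fderiv ℝ u z‖ ^ 2 := by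
  have h : Continuous (fderiv ℝ u) := hu.1.continuous_fderiv (by simp)
  have hc : HasCompactSupport fun z => ‖fderiv ℝ u z‖ ^ 2 :=
    hu.2.1.mono' fun z hz => support_fderiv_subset ℝ fun h => hz (by simp [h])
  exact (h.norm.pow 2).integrable_of_hasCompactSupport hc

theorem norm_sq_eq_apply_one_sq_add_apply_I_sq (L : ℂ →L[ℝ] ℝ) :
    ‖L‖ ^ 2 = L 1 ^ 2 + L Complex.I ^ 2 := by
  rw [← norm_apply_one_sub_I_mul_apply_I, ← Complex.normSq_eq_norm_sq, Complex.normSq_apply]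
  simp only [Complex.sub_re, Complex.ofReal_re, Complex.mul_re, Complex.I_re, zero_mul,
    Complex.I_im, Complex.ofReal_im, mul_zero, sub_self, sub_zero, Complex.sub_im, Complex.mul_im,
    one_mul, zero_add, zero_sub, mul_neg, neg_mul, neg_neg]
  ring

theorem lintegral_enorm_sq_eq_ofReal_integral {α E : Type*} {m : MeasurableSpace α}
    {μ : Measure α} [NormedAddCommGroup E] {f : α → E} (hf : Integrable (fun x => ‖f x‖ ^ 2) μ) :
    ∫⁻ x, ‖f x‖ₑ ^ 2 ∂μ = ENNReal.ofReal (∫ x, ‖f x‖ ^ 2 ∂μ) := by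
  rw [ofReal_integral_eq_lintegral_ofReal hf (.of_forall fun x => sq_nonneg _)]
  refine lintegral_congr fun x => ?_
  rw [ENNReal.ofReal_pow (norm_nonneg _), ofReal_norm]

namespace IsComplexTest

variable {Ω : Set ℂ} {φ : ℂ → ℂ}

theorem isTestFunction_re (hφ : IsComplexTest Ω φ) : IsTestFunction Ω fun z => (φ z).re :=
  ⟨Complex.reCLM.contDiff.comp hφ.contDiff, hφ.hasCompactSupport.comp_left Complex.zero_re,
    (closure_mono (Function.support_comp_subset Complex.zero_re φ)).trans hφ.tsupport_subset⟩

theorem isTestFunction_im (hφ : IsComplexTest Ω φ) : IsTestFunction Ω fun z => (φ z).im :=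
  ⟨Complex.imCLM.contDiff.comp hφ.contDiff, hφ.hasCompactSupport.comp_left Complex.zero_im,
    (closure_mono (Function.support_comp_subset Complex.zero_im φ)).trans hφ.tsupport_subset⟩

theorem norm_dz_sq (hφ : IsComplexTest Ω φ) (z : ℂ) :
    ‖dz φ z‖ ^ 2 =
      ‖fderiv ℝ (fun z => (φ z).re) z‖ ^ 2 + ‖fderiv ℝ (fun z => (φ z).im) z‖ ^ 2 +
      2 * (fderiv ℝ (fun z => (φ z).re) z 1 * fderiv ℝ (fun z => (φ z).im) z Complex.I -
        fderiv ℝ (fun z => (φ z).re) z Complex.I * fderiv ℝ (fun z => (φ z).im) z 1) := by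
  have hφz := (hφ.differentiable z).hasFDerivAt
  have hre : HasFDerivAt (fun z => (φ z).re) _ z := Complex.reCLM.hasFDerivAt.comp z hφz
  have him : HasFDerivAt (fun z => (φ z).im) _ z := Complex.imCLM.hasFDerivAt.comp z hφz
  rw [norm_sq_eq_apply_one_sq_add_apply_I_sq, norm_sq_eq_apply_one_sq_add_apply_I_sq, hre.fderiv,
    him.fderiv, dz, ← Complex.normSq_eq_norm_sq, Complex.normSq_apply]
  simp only [Complex.sub_re, Complex.mul_re, Complex.I_re, zero_mul, Complex.I_im, one_mul,
    zero_sub, sub_neg_eq_add, Complex.sub_im, Complex.mul_im, zero_add,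
    ContinuousLinearMap.comp_apply, Complex.reCLM_apply, Complex.imCLM_apply]
  ring

theorem lintegral_enorm_dz_sq (hφ : IsComplexTest Ω φ) :
    ∫⁻ z, ‖dz φ z‖ₑ ^ 2 = (∫⁻ z, ‖fderiv ℝ (fun z => (φ z).re) z‖ₑ ^ 2) +
      ∫⁻ z, ‖fderiv ℝ (fun z => (φ z).im) z‖ₑ ^ 2 := by
  have hre := hφ.isTestFunction_re
  have him := hφ.isTestFunction_im
  have hu : ContDiff ℝ 1 fun z => (φ z).re := hre.1.of_le (by simp)
  have hv : ContDiff ℝ 2 fun z => (φ z).im := him.1.of_le (WithTop.coe_le_coe.2 le_top)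
  have hint := integrable_fderiv_apply_mul_fderiv_apply (μ := volume) hu hre.2.1
    (hv.of_le one_le_two)
  have hdz : Integrable fun z => ‖dz φ z‖ ^ 2 :=
    (hφ.memLp_dz volume).integrable_norm_pow two_ne_zero
  have hre' := hre.integrable_norm_fderiv_sq
  have him' := him.integrable_norm_fderiv_sq
  have hJ : ∫ z, (fderiv ℝ (fun z => (φ z).re) z 1 * fderiv ℝ (fun z => (φ z).im) z Complex.I -
      fderiv ℝ (fun z => (φ z).re) z Complex.I * fderiv ℝ (fun z => (φ z).im) z 1) = 0 := by
    rw [integral_sub (hint _ _) (hint _ _), integral_fderiv_mul_fderiv_comm hu hre.2.1 hv,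
      sub_self]
  rw [lintegral_enorm_sq_eq_ofReal_integral hdz, lintegral_enorm_sq_eq_ofReal_integral hre',
    lintegral_enorm_sq_eq_ofReal_integral him',
    ← ENNReal.ofReal_add (integral_nonneg fun z => sq_nonneg _)
      (integral_nonneg fun z => sq_nonneg _)]
  simp_rw [hφ.norm_dz_sq]
  refine congrArg ENNReal.ofReal
    ((integral_add (hre'.add him') (((hint _ _).sub (hint _ _)).const_mul 2)).trans ?_)
  simp only [Pi.add_apply, Pi.sub_apply]
  rw [integral_const_mul, hJ, mul_zero, add_zero, integral_add hre' him']

theorem hardyConstant_sq_mul_lintegral_le (hφ : IsComplexTest Ω φ) :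
    hardyConstant Ω ^ 2 * ∫⁻ z in Ω, ‖φ z‖ₑ ^ 2 / boundaryDist Ω z ^ 2 ≤
      ∫⁻ z, ‖dz φ z‖ₑ ^ 2 := by
  have hsplit : ∀ z, ‖φ z‖ₑ ^ 2 = ‖(φ z).re‖ₑ ^ 2 + ‖(φ z).im‖ₑ ^ 2 := fun z => by
    simp only [← ofReal_norm, ← ENNReal.ofReal_pow (norm_nonneg _)]
    rw [← ENNReal.ofReal_add (by positivity) (by positivity), ← Complex.normSq_eq_norm_sq,
      Complex.normSq_apply, Real.norm_eq_abs, Real.norm_eq_abs, sq_abs, sq_abs, sq, sq]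
  have hm : Measurable fun z => ‖(φ z).re‖ₑ ^ 2 / boundaryDist Ω z ^ 2 :=
    (hφ.isTestFunction_re.1.continuous.measurable.enorm.pow_const 2).div
      (measurable_infEDist.pow_const 2)
  simp_rw [hsplit, ENNReal.add_div]
  rw [lintegral_add_left hm, mul_add, hφ.lintegral_enorm_dz_sq]
  gcongr ?_ + ?_
  · exact (hφ.isTestFunction_re.hardyConstant_sq_mul_lintegral_le).trans
      (setLIntegral_le_lintegral _ _)
  · exact (hφ.isTestFunction_im.hardyConstant_sq_mul_lintegral_le).trans
      (setLIntegral_le_lintegral _ _)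

end IsComplexTest

/-! ### Weighted estimates -/

theorem eLpNorm_two_sq {α E : Type*} {m : MeasurableSpace α} [NormedAddCommGroup E] (f : α → E)
    (μ : Measure α) : eLpNorm f 2 μ ^ 2 = ∫⁻ x, ‖f x‖ₑ ^ 2 ∂μ := by
  simpa only [NNReal.coe_ofNat, ENNReal.coe_ofNat, ENNReal.rpow_ofNat] using
    eLpNorm_nnreal_pow_eq_lintegral (μ := μ) (f := f) (two_ne_zero (α := ℝ≥0))

theorem norm_le_mul_norm_add_sub_of_inner_eq_zero {𝕜 H : Type*} [RCLike 𝕜] [NormedAddCommGroup H]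
    [InnerProductSpace 𝕜 H] {P Q x : H} {c : ℝ} (hc0 : 0 ≤ c) (hc1 : c < 1)
    (hQ : ‖Q‖ ≤ c * ‖P‖) (hx : inner 𝕜 (P + Q) x = 0) :
    ‖x‖ ≤ 2 / (1 - c) * ‖x + (P - Q)‖ := by
  set y := x + (P - Q) with hy
  have hdiff : ‖P‖ ^ 2 - ‖Q‖ ^ 2 ≤ (‖P‖ + ‖Q‖) * ‖y‖ :=
    calc ‖P‖ ^ 2 - ‖Q‖ ^ 2 = RCLike.re (inner 𝕜 (P + Q) (P - Q)) := by
          rw [inner_add_left, inner_sub_right, inner_sub_right]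
          simp only [map_add, map_sub, inner_self_eq_norm_sq]
          rw [inner_re_symm (𝕜 := 𝕜) P Q]
          ring
      _ = RCLike.re (inner 𝕜 (P + Q) y) := by rw [hy, inner_add_right, hx, zero_add]
      _ ≤ ‖P + Q‖ * ‖y‖ := (RCLike.re_le_norm _).trans (norm_inner_le_norm _ _)
      _ ≤ (‖P‖ + ‖Q‖) * ‖y‖ := by gcongr; exact norm_add_le P Q
  have hP : (1 - c) * ‖P‖ ≤ ‖y‖ := by
    rcases (norm_nonneg P).eq_or_lt with h | h
    · simp [← h]
    · have : ‖P‖ - ‖Q‖ ≤ ‖y‖ :=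
        le_of_mul_le_mul_left (by linarith) (add_pos_of_pos_of_nonneg h (norm_nonneg Q))
      linarith
  have htri : ‖x‖ ≤ ‖y‖ + (1 + c) * ‖P‖ :=
    calc ‖x‖ = ‖y - (P - Q)‖ := by rw [hy, add_sub_cancel_right]
      _ ≤ ‖y‖ + (‖P‖ + ‖Q‖) := (norm_sub_le _ _).trans (by gcongr; exact norm_sub_le P Q)
      _ ≤ ‖y‖ + (1 + c) * ‖P‖ := by linarith
  rw [div_mul_eq_mul_div, le_div_iff₀ (sub_pos.2 hc1)]
  nlinarith [mul_le_mul_of_nonneg_left hP (by linarith : 0 ≤ 1 + c)]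

theorem eLpNorm_le_mul_eLpNorm_add_sub {α : Type*} {m : MeasurableSpace α} {μ : Measure α}
    {P Q f : α → ℂ} (hP : MemLp P 2 μ) (hQ : MemLp Q 2 μ) (hf : MemLp f 2 μ) {c : ℝ≥0}
    (hc : c < 1) (hQP : eLpNorm Q 2 μ ≤ c * eLpNorm P 2 μ)
    (horth : ∫ x, f x * conj ((P + Q) x) ∂μ = 0) :
    eLpNorm f 2 μ ≤ ENNReal.ofReal (2 / (1 - c)) * eLpNorm (f + (P - Q)) 2 μ := by
  have hle : ‖hQ.toLp Q‖ ≤ c * ‖hP.toLp P‖ := by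
    rw [Lp.norm_toLp, Lp.norm_toLp, ← ENNReal.coe_toReal c, ← ENNReal.toReal_mul]
    exact ENNReal.toReal_mono (ENNReal.mul_ne_top ENNReal.coe_ne_top hP.2.ne) hQP
  have hin : inner ℂ (hP.toLp P + hQ.toLp Q) (hf.toLp f) = 0 := by
    rw [← MemLp.toLp_add, inner_eq_integral_mul_conj (MemLp.coeFn_toLp _) hf.coeFn_toLp, horth]
  have h := ENNReal.ofReal_le_ofReal
    (norm_le_mul_norm_add_sub_of_inner_eq_zero c.coe_nonneg (NNReal.coe_lt_one.2 hc) hle hin)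
  rwa [← MemLp.toLp_sub, ← MemLp.toLp_add, ENNReal.ofReal_mul (div_nonneg two_pos.le
    (sub_nonneg.2 (NNReal.coe_le_one.2 hc.le))), ofReal_norm, ofReal_norm, Lp.enorm_toLp,
    Lp.enorm_toLp] at h

/-- A bounded smooth weight on `Ω` whose logarithmic gradient is at most `τ / δ_Ω`. The model case
is `δ_Ω ^ (-τ)`, truncated to be bounded. -/
structure IsHardyWeight (Ω : Set ℂ) (τ : ℝ≥0) (η : ℂ → ℝ) : Prop where
  contDiffOn : ContDiffOn ℝ ∞ η Ω
  bounded : ∃ M : ℝ≥0, ∀ z ∈ Ω, ‖η z‖ ≤ M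
  enorm_fderiv_le : ∀ z ∈ Ω, ‖fderiv ℝ η z‖ₑ ≤ τ * (‖η z‖ₑ / boundaryDist Ω z)

namespace IsHardyWeight

variable {Ω : Set ℂ} {τ c : ℝ≥0} {η : ℂ → ℝ} {f k φ : ℂ → ℂ}

theorem contDiffOn_ofReal (hη : IsHardyWeight Ω τ η) :
    ContDiffOn ℝ ∞ (fun z => (η z : ℂ)) Ω :=
  Complex.ofRealCLM.contDiff.comp_contDiffOn hη.contDiffOn

theorem aestronglyMeasurable_mul (hη : IsHardyWeight Ω τ η) (hΩ : IsOpen Ω)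
    (hf : AEStronglyMeasurable f (volume.restrict Ω)) :
    AEStronglyMeasurable (fun z => η z * f z) (volume.restrict Ω) :=
  (hη.contDiffOn_ofReal.continuousOn.aestronglyMeasurable hΩ.measurableSet).mul hf

theorem exists_eLpNorm_mul_le (hη : IsHardyWeight Ω τ η) (hΩ : IsOpen Ω) :
    ∃ M : ℝ≥0, ∀ f : ℂ → ℂ, eLpNorm (fun z => η z * f z) 2 (volume.restrict Ω) ≤
      M * eLpNorm f 2 (volume.restrict Ω) := by
  obtain ⟨M, hM⟩ := hη.bounded
  refine ⟨M, fun f => eLpNorm_le_nnreal_smul_eLpNorm_of_ae_le_mul ?_ 2⟩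
  filter_upwards [ae_restrict_mem hΩ.measurableSet] with z hz
  rw [nnnorm_mul, Complex.nnnorm_real]
  exact mul_le_mul_of_nonneg_right (hM z hz) zero_le

theorem memLp_mul (hη : IsHardyWeight Ω τ η) (hΩ : IsOpen Ω)
    (hf : MemLp f 2 (volume.restrict Ω)) : MemLp (fun z => η z * f z) 2 (volume.restrict Ω) := by
  obtain ⟨M, hM⟩ := hη.exists_eLpNorm_mul_le hΩ
  exact ⟨hη.aestronglyMeasurable_mul hΩ hf.1,
    (hM f).trans_lt (ENNReal.mul_lt_top ENNReal.coe_lt_top hf.2)⟩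

theorem eLpNorm_mul_dz_le (hη : IsHardyWeight Ω τ η) (hΩ : IsOpen Ω)
    (hτ : τ ≤ c * hardyConstant Ω) (hφ : IsComplexTest Ω φ) :
    eLpNorm (fun z => φ z * dz (fun z => η z) z) 2 (volume.restrict Ω) ≤
      c * eLpNorm (dz fun z => η z * φ z) 2 (volume.restrict Ω) := by
  have hηφ := hφ.mul_left hΩ hη.contDiffOn_ofReal
  have hpt : ∀ z ∈ Ω, ‖φ z * dz (fun z => η z) z‖ₑ ^ 2 ≤
      τ ^ 2 * (‖η z * φ z‖ₑ ^ 2 / boundaryDist Ω z ^ 2) := fun z hz => by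
    have hηz : DifferentiableAt ℝ η z :=
      (hη.contDiffOn.contDiffAt (hΩ.mem_nhds hz)).differentiableAt (by simp)
    calc ‖φ z * dz (fun z => η z) z‖ₑ ^ 2 = ‖φ z‖ₑ ^ 2 * ‖fderiv ℝ η z‖ₑ ^ 2 := by
          rw [enorm_mul, mul_pow, ← ofReal_norm (dz _ z), norm_dz_ofReal hηz, ofReal_norm]
      _ ≤ ‖φ z‖ₑ ^ 2 * (τ * (‖η z‖ₑ / boundaryDist Ω z)) ^ 2 := by
          gcongr
          exact hη.enorm_fderiv_le z hz
      _ = τ ^ 2 * (‖η z * φ z‖ₑ ^ 2 / boundaryDist Ω z ^ 2) := by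
          rw [enorm_mul, ← ofReal_norm (η z : ℂ), Complex.norm_real, ofReal_norm]
          simp only [div_eq_mul_inv, mul_pow, ENNReal.inv_pow]
          ring
  refine (ENNReal.pow_le_pow_left_iff two_ne_zero).1 ?_
  calc eLpNorm (fun z => φ z * dz (fun z => η z) z) 2 (volume.restrict Ω) ^ 2
      ≤ ∫⁻ z in Ω, τ ^ 2 * (‖η z * φ z‖ₑ ^ 2 / boundaryDist Ω z ^ 2) := by
        rw [eLpNorm_two_sq]
        exact setLIntegral_mono' hΩ.measurableSet hpt
    _ ≤ (c * hardyConstant Ω) ^ 2 * ∫⁻ z in Ω, ‖η z * φ z‖ₑ ^ 2 / boundaryDist Ω z ^ 2 := by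
        rw [lintegral_const_mul' _ _ (by finiteness)]
        gcongr
    _ ≤ c ^ 2 * ∫⁻ z, ‖dz (fun z => η z * φ z) z‖ₑ ^ 2 := by
        rw [mul_pow, mul_assoc]
        gcongr
        exact hηφ.hardyConstant_sq_mul_lintegral_le
    _ = (c * eLpNorm (dz fun z => η z * φ z) 2 (volume.restrict Ω)) ^ 2 := by
        rw [mul_pow, eLpNorm_two_sq, setLIntegral_eq_of_support_subset fun z hz =>
          hηφ.tsupport_subset (support_dz_subset _ fun h => hz (by simp [h]))]

/-- Writing `P = ∂(ηφ)` and `Q = φ ∂η`, one has `∂(η² φ) = η (P + Q)` and `η ∂φ = P - Q`. The first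
identity makes `P + Q` orthogonal to `η k`, and Hardy's inequality makes `Q` smaller than `P`. -/
theorem eLpNorm_mul_le_add_dz (hη : IsHardyWeight Ω τ η) (hΩ : IsOpen Ω) (hc : c < 1)
    (hτ : τ ≤ c * hardyConstant Ω) (hk : MemBergman Ω k) (hφ : IsComplexTest Ω φ) :
    eLpNorm (fun z => η z * k z) 2 (volume.restrict Ω) ≤
      ENNReal.ofReal (2 / (1 - c)) *
        eLpNorm (fun z => η z * (k z + dz φ z)) 2 (volume.restrict Ω) := by
  have hηφ := hφ.mul_left hΩ hη.contDiffOn_ofReal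
  have hηd : ∀ z ∈ Ω, DifferentiableAt ℝ (fun z => (η z : ℂ)) z := fun z hz =>
    (hη.contDiffOn_ofReal.contDiffAt (hΩ.mem_nhds hz)).differentiableAt (by simp)
  set P : ℂ → ℂ := dz fun z => η z * φ z with hP
  set Q : ℂ → ℂ := fun z => φ z * dz (fun z => η z) z with hQ
  have hsub : ∀ z ∈ Ω, P z - Q z = η z * dz φ z := fun z hz => by
    simp only [hP, hQ, dz_mul (hηd z hz) (hφ.differentiable z)]
    ring
  have hadd : ∀ z ∈ Ω, dz (fun z => η z * (η z * φ z)) z = η z * (P z + Q z) := fun z hz => by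
    rw [dz_mul (hηd z hz) (hηφ.differentiable z)]
    simp only [hP, hQ]
    ring
  have hPmem : MemLp P 2 (volume.restrict Ω) := hηφ.memLp_dz _
  have hQmem : MemLp Q 2 (volume.restrict Ω) := by
    refine MemLp.ae_eq ?_ (hPmem.sub (hη.memLp_mul hΩ (hφ.memLp_dz _)))
    filter_upwards [ae_restrict_mem hΩ.measurableSet] with z hz
    rw [Pi.sub_apply, ← hsub z hz, sub_sub_cancel]
  have horth : ∫ z in Ω, η z * k z * conj ((P + Q) z) = 0 := by
    rw [← setIntegral_mul_conj_dz_eq_zero hΩ hk.1 (hηφ.mul_left hΩ hη.contDiffOn_ofReal)]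
    refine setIntegral_congr_fun hΩ.measurableSet fun z hz => ?_
    simp only [hadd z hz, Pi.add_apply, map_mul, Complex.conj_ofReal]
    ring
  refine (eLpNorm_le_mul_eLpNorm_add_sub hPmem hQmem (hη.memLp_mul hΩ hk.2) hc
    (hη.eLpNorm_mul_dz_le hΩ hτ hφ) horth).trans_eq ?_
  congr 1
  refine eLpNorm_congr_ae ?_
  filter_upwards [ae_restrict_mem hΩ.measurableSet] with z hz
  simp only [Pi.add_apply, Pi.sub_apply, hsub z hz, mul_add]

theorem eLpNorm_mul_le (hη : IsHardyWeight Ω τ η) (hΩ : IsOpen Ω) (hc : c < 1)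
    (hτ : τ ≤ c * hardyConstant Ω) (hk : MemBergman Ω k) (hf : MemLp f 2 (volume.restrict Ω))
    (hkf : ∀ g, MemBergman Ω g → ∫ z in Ω, g z * conj (k z) = ∫ z in Ω, g z * conj (f z)) :
    eLpNorm (fun z => η z * k z) 2 (volume.restrict Ω) ≤
      ENNReal.ofReal (2 / (1 - c)) * eLpNorm (fun z => η z * f z) 2 (volume.restrict Ω) := by
  obtain ⟨φ, hφ, hlim⟩ := exists_tendsto_eLpNorm_sub_dz hΩ (hf.sub hk.2) fun g hg => by
    simp only [Pi.sub_apply, map_sub, mul_sub]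
    exact (integral_sub (hg.2.integrable_mul hf.star) (hg.2.integrable_mul hk.2.star)).trans
      (sub_eq_zero.2 (hkf g hg).symm)
  obtain ⟨M, hM⟩ := hη.exists_eLpNorm_mul_le hΩ
  set a := fun n => eLpNorm (f - k - dz (φ n)) 2 (volume.restrict Ω)
  have hbound : ∀ n, eLpNorm (fun z => η z * k z) 2 (volume.restrict Ω) ≤
      ENNReal.ofReal (2 / (1 - c)) *
        (eLpNorm (fun z => η z * f z) 2 (volume.restrict Ω) + M * a n) := fun n => by
    refine (hη.eLpNorm_mul_le_add_dz hΩ hc hτ hk (hφ n)).trans ?_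
    gcongr
    have hsplit : (fun z => η z * (k z + dz (φ n) z)) =
        (fun z => (η z : ℂ) * f z) - fun z => η z * (f - k - dz (φ n)) z := by
      funext z
      simp only [Pi.sub_apply]
      ring
    rw [hsplit]
    refine (eLpNorm_sub_le (hη.aestronglyMeasurable_mul hΩ hf.1) (hη.aestronglyMeasurable_mul hΩ
      ((hf.sub hk.2).sub ((hφ n).memLp_dz _)).1) one_le_two).trans ?_
    gcongr
    exact hM _
  have hM0 : Filter.Tendsto (fun n => M * a n) Filter.atTop (nhds 0) := by
    simpa only [mul_zero] using ENNReal.Tendsto.const_mul hlim (.inr ENNReal.coe_ne_top)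
  have hlim' := ENNReal.Tendsto.const_mul (a := ENNReal.ofReal (2 / (1 - c)))
    (hM0.const_add (eLpNorm (fun z => η z * f z) 2 (volume.restrict Ω)))
    (.inr ENNReal.ofReal_ne_top)
  rw [add_zero] at hlim'
  exact ge_of_tendsto' hlim' hbound

end IsHardyWeight

/-! ### Smooth approximations of negative powers of a distance -/

section LogarithmicGradient

variable {E : Type*} [NormedAddCommGroup E]

theorem norm_fderiv_rpow_mul_le [NormedSpace ℝ E] {g : E → ℝ} {x : E} {c d : ℝ}
    (hg : DifferentiableAt ℝ g x) (hpos : 0 < g x) (h : ‖fderiv ℝ g x‖ * d ≤ c * g x) (p : ℝ) :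
    ‖fderiv ℝ (fun x => g x ^ p) x‖ * d ≤ |p| * c * g x ^ p := by
  rw [(hg.hasFDerivAt.rpow_const (.inl hpos.ne')).fderiv, norm_smul, Real.norm_eq_abs, abs_mul,
    abs_of_nonneg (Real.rpow_nonneg hpos.le _), mul_assoc]
  calc |p| * g x ^ (p - 1) * (‖fderiv ℝ g x‖ * d) ≤ |p| * g x ^ (p - 1) * (c * g x) := by gcongr
    _ = |p| * c * g x ^ p := by
        rw [Real.rpow_sub_one hpos.ne']
        field_simp

theorem norm_fderiv_sum_mul_le [NormedSpace ℝ E] {ι : Type*} {s : Finset ι} {g : ι → E → ℝ} {x : E}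
    {c d : ℝ} (hd : 0 ≤ d) (hg : ∀ i ∈ s, DifferentiableAt ℝ (g i) x)
    (h : ∀ i ∈ s, ‖fderiv ℝ (g i) x‖ * d ≤ c * g i x) :
    ‖fderiv ℝ (fun x => ∑ i ∈ s, g i x) x‖ * d ≤ c * ∑ i ∈ s, g i x := by
  rw [fderiv_fun_sum hg, Finset.mul_sum]
  calc ‖∑ i ∈ s, fderiv ℝ (g i) x‖ * d ≤ (∑ i ∈ s, ‖fderiv ℝ (g i) x‖) * d := by
        gcongr
        exact norm_sum_le _ _
    _ ≤ ∑ i ∈ s, c * g i x := (Finset.sum_mul _ _ _).trans_le (Finset.sum_le_sum h)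

theorem norm_fderiv_norm_sub_sq_add_mul_le [InnerProductSpace ℝ E] {a x : E} {d ε : ℝ}
    (hd : d ≤ ‖x - a‖) (hε : 0 ≤ ε) :
    ‖fderiv ℝ (fun x => ‖x - a‖ ^ 2 + ε) x‖ * d ≤ 2 * (‖x - a‖ ^ 2 + ε) := by
  have h : HasFDerivAt (fun x => ‖x - a‖ ^ 2 + ε) (2 • innerSL ℝ (x - a)) x :=
    (((hasFDerivAt_id x).sub_const a).norm_sq.add_const ε).congr_fderiv (by simp)
  rw [h.fderiv, ← Nat.cast_smul_eq_nsmul ℝ, norm_smul, innerSL_apply_norm, Nat.cast_ofNat,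
    Real.norm_two]
  nlinarith [norm_nonneg (x - a)]

end LogarithmicGradient

section PoleWeight

variable {E : Type*} [NormedAddCommGroup E]

/-- A regularization of `∑_{j ≤ n} ‖x - a j‖ ^ (-2 (n + 1))`. -/
def poleSum (a : ℕ → E) (n : ℕ) (x : E) : ℝ :=
  ∑ j ∈ Finset.range (n + 1), (‖x - a j‖ ^ 2 + ((n : ℝ) + 1)⁻¹) ^ (-((n : ℝ) + 1))

/-- A bounded approximation of `dist(x, {a j}) ^ (-τ)`: an `ℓ^p` norm, with `p = 2 (n + 1)`, in
place of the supremum over `j` of `‖x - a j‖⁻¹`, raised to the power `τ`. -/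
def poleWeight (a : ℕ → E) (τ : ℝ) (n : ℕ) (x : E) : ℝ :=
  poleSum a n x ^ (τ / (2 * (n + 1)))

variable (a : ℕ → E) {τ : ℝ} (n : ℕ) (x : E)

theorem poleSum_pos : 0 < poleSum a n x :=
  Finset.sum_pos (fun j _ => by positivity) ⟨0, by simp⟩

theorem poleWeight_pos : 0 < poleWeight a τ n x :=
  Real.rpow_pos_of_pos (poleSum_pos a n x) _

theorem infDist_range_le_norm_sub (j : ℕ) : infDist x (Set.range a) ≤ ‖x - a j‖ :=
  (infDist_le_dist_of_mem (Set.mem_range_self j)).trans_eq (dist_eq_norm _ _)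

variable {a n x}

theorem poleWeight_le_of_le {D : ℝ} (hτ : 0 ≤ τ) (hD : 0 < D)
    (h : ∀ j, D ≤ ‖x - a j‖ ^ 2 + ((n : ℝ) + 1)⁻¹) :
    poleWeight a τ n x ≤ 2 ^ (τ / 2) * D ^ (-τ / 2) := by
  have hsum : poleSum a n x ≤ 2 ^ ((n : ℝ) + 1) * D ^ (-((n : ℝ) + 1)) :=
    calc poleSum a n x ≤ ∑ _j ∈ Finset.range (n + 1), D ^ (-((n : ℝ) + 1)) :=
          Finset.sum_le_sum fun j _ => Real.rpow_le_rpow_of_nonpos hD (h j) (by linarith)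
      _ = (n + 1 : ℕ) * D ^ (-((n : ℝ) + 1)) := by
          rw [Finset.sum_const, Finset.card_range, nsmul_eq_mul]
      _ ≤ 2 ^ ((n : ℝ) + 1) * D ^ (-((n : ℝ) + 1)) := by
          gcongr
          exact_mod_cast (n + 1).lt_two_pow_self.le
  calc poleWeight a τ n x
      ≤ (2 ^ ((n : ℝ) + 1) * D ^ (-((n : ℝ) + 1))) ^ (τ / (2 * (n + 1))) :=
        Real.rpow_le_rpow (poleSum_pos a n x).le hsum (by positivity)
    _ = 2 ^ (τ / 2) * D ^ (-τ / 2) := by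
        rw [Real.mul_rpow (by positivity) (by positivity), ← Real.rpow_mul two_pos.le,
          ← Real.rpow_mul hD.le]
        congr 2 <;> field_simp

theorem poleWeight_le_rpow_infDist (hτ : 0 ≤ τ) (hx : 0 < infDist x (Set.range a)) :
    poleWeight a τ n x ≤ 2 ^ (τ / 2) * infDist x (Set.range a) ^ (-τ) := by
  refine (poleWeight_le_of_le hτ (pow_pos hx 2) fun j => ?_).trans_eq ?_
  · have := pow_le_pow_left₀ hx.le (infDist_range_le_norm_sub a x j) 2
    have : 0 < ((n : ℝ) + 1)⁻¹ := by positivity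
    linarith
  · rw [← Real.rpow_natCast, ← Real.rpow_mul hx.le]
    congr 2
    push_cast
    ring

theorem le_poleWeight (hτ : 0 ≤ τ) {j : ℕ} (hj : j ≤ n) :
    (‖x - a j‖ ^ 2 + ((n : ℝ) + 1)⁻¹) ^ (-τ / 2) ≤ poleWeight a τ n x := by
  have hle : (‖x - a j‖ ^ 2 + ((n : ℝ) + 1)⁻¹) ^ (-((n : ℝ) + 1)) ≤ poleSum a n x :=
    Finset.single_le_sum
      (f := fun j => (‖x - a j‖ ^ 2 + ((n : ℝ) + 1)⁻¹) ^ (-((n : ℝ) + 1)))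
      (fun j _ => by positivity) (Finset.mem_range_succ_iff.2 hj)
  refine le_of_eq_of_le ?_ (Real.rpow_le_rpow (by positivity) hle (by positivity))
  rw [← Real.rpow_mul (by positivity)]
  congr 1
  field_simp

theorem eventually_lt_poleWeight (hτ : 0 ≤ τ) (hx : 0 < infDist x (Set.range a)) {c : ℝ}
    (hc : c < infDist x (Set.range a) ^ (-τ)) :
    ∀ᶠ n in Filter.atTop, c < poleWeight a τ n x := by
  obtain ⟨j, hj⟩ : ∃ j, c < ‖x - a j‖ ^ (-τ) := by
    have hnhds := (Real.continuousAt_rpow_const _ (-τ) (.inl hx.ne')).eventually (lt_mem_nhds hc)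
    obtain ⟨δ, hδ, hδc⟩ := Metric.eventually_nhds_iff.1 hnhds
    obtain ⟨_, ⟨j, rfl⟩, hj⟩ :=
      (infDist_lt_iff (Set.range_nonempty a)).1 (lt_add_of_pos_right (infDist x _) hδ)
    refine ⟨j, hδc ?_⟩
    rw [dist_eq_norm] at hj
    rw [Real.dist_eq, abs_of_nonneg (sub_nonneg.2 (infDist_range_le_norm_sub a x j))]
    linarith
  have hpos : 0 < ‖x - a j‖ := hx.trans_le (infDist_range_le_norm_sub a x j)
  have hlim : Filter.Tendsto (fun n : ℕ => (‖x - a j‖ ^ 2 + ((n : ℝ) + 1)⁻¹) ^ (-τ / 2))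
      Filter.atTop (nhds (‖x - a j‖ ^ (-τ))) := by
    have h : ‖x - a j‖ ^ (-τ) = (‖x - a j‖ ^ 2 + 0) ^ (-τ / 2) := by
      rw [add_zero, ← Real.rpow_natCast, ← Real.rpow_mul hpos.le]
      congr 1
      push_cast
      ring
    rw [h]
    simp only [← one_div]
    exact (tendsto_const_nhds.add tendsto_one_div_add_atTop_nhds_zero_nat).rpow_const
      (.inl (by positivity))
  filter_upwards [hlim.eventually (lt_mem_nhds hj), Filter.eventually_ge_atTop j] with n hn hjn
  exact hn.trans_le (le_poleWeight hτ hjn)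

variable [InnerProductSpace ℝ E] (a n x)

theorem contDiff_norm_sub_sq_add_inv_rpow (j : ℕ) (p : ℝ) :
    ContDiff ℝ ∞ fun x => (‖x - a j‖ ^ 2 + ((n : ℝ) + 1)⁻¹) ^ p :=
  (((contDiff_id.sub contDiff_const).norm_sq ℝ).add contDiff_const).rpow_const_of_ne
    fun x => (by positivity : 0 < ‖x - a j‖ ^ 2 + ((n : ℝ) + 1)⁻¹).ne'

theorem contDiff_poleSum : ContDiff ℝ ∞ (poleSum a n) :=
  ContDiff.sum fun j _ => contDiff_norm_sub_sq_add_inv_rpow a n j _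

theorem contDiff_poleWeight : ContDiff ℝ ∞ (poleWeight a τ n) :=
  (contDiff_poleSum a n).rpow_const_of_ne fun x => (poleSum_pos a n x).ne'

theorem norm_fderiv_poleWeight_mul_infDist_le (hτ : 0 ≤ τ) :
    ‖fderiv ℝ (poleWeight a τ n) x‖ * infDist x (Set.range a) ≤ τ * poleWeight a τ n x := by
  have hterm : ∀ j, ‖fderiv ℝ (fun x => (‖x - a j‖ ^ 2 + ((n : ℝ) + 1)⁻¹) ^ (-((n : ℝ) + 1))) x‖ *
      infDist x (Set.range a) ≤ |-((n : ℝ) + 1)| * 2 *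
        (‖x - a j‖ ^ 2 + ((n : ℝ) + 1)⁻¹) ^ (-((n : ℝ) + 1)) := fun j =>
    norm_fderiv_rpow_mul_le (g := fun x => ‖x - a j‖ ^ 2 + ((n : ℝ) + 1)⁻¹)
      ((((contDiff_id.sub contDiff_const).norm_sq ℝ).add contDiff_const).differentiable
        one_ne_zero x) (by positivity)
      (norm_fderiv_norm_sub_sq_add_mul_le (infDist_range_le_norm_sub a x j) (by positivity)) _
  have hsum : ‖fderiv ℝ (poleSum a n) x‖ * infDist x (Set.range a) ≤
      |-((n : ℝ) + 1)| * 2 * poleSum a n x :=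
    norm_fderiv_sum_mul_le infDist_nonneg (fun j _ =>
      (contDiff_norm_sub_sq_add_inv_rpow a n j _).differentiable (by simp) x) fun j _ => hterm j
  refine (norm_fderiv_rpow_mul_le ((contDiff_poleSum a n).differentiable (by simp) x)
    (poleSum_pos a n x) hsum (τ / (2 * (n + 1)))).trans_eq ?_
  rw [poleWeight, abs_neg, abs_of_nonneg (by positivity), abs_of_nonneg (by positivity)]
  field_simp

end PoleWeight

/-! ### Hardy weights from the boundary distance -/

theorem infDist_frontier_pos {X : Type*} [PseudoMetricSpace X] {Ω : Set X} (hΩ : IsOpen Ω)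
    (hF : (frontier Ω).Nonempty) {x : X} (hx : x ∈ Ω) : 0 < infDist x (frontier Ω) :=
  (isClosed_frontier.notMem_iff_infDist_pos hF).1 fun h => (hΩ.frontier_eq ▸ h).2 hx

theorem boundaryDist_eq_ofReal {Ω : Set ℂ} (hF : (frontier Ω).Nonempty) (z : ℂ) :
    boundaryDist Ω z = ENNReal.ofReal (infDist z (frontier Ω)) :=
  (ENNReal.ofReal_toReal (infEDist_ne_top hF)).symm

theorem exists_closure_range_eq {X : Type*} [PseudoMetricSpace X]
    [TopologicalSpace.SeparableSpace X] {F : Set X} (hF : IsClosed F) (hne : F.Nonempty) :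
    ∃ a : ℕ → X, closure (Set.range a) = F := by
  have hsep : TopologicalSpace.IsSeparable F := .of_separableSpace F
  obtain ⟨t, htF, ht, hFt⟩ := hsep.exists_countable_dense_subset
  obtain ⟨a, rfl⟩ := ht.exists_eq_range (closure_nonempty_iff.1 (hne.mono hFt))
  exact ⟨a, (closure_minimal htF hF).antisymm hFt⟩

theorem isHardyWeight_poleWeight {Ω : Set ℂ} (hΩ : IsOpen Ω) {a : ℕ → ℂ}
    (ha : closure (Set.range a) = frontier Ω) (τ : ℝ≥0) (n : ℕ) :
    IsHardyWeight Ω τ (poleWeight a τ n) where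
  contDiffOn := (contDiff_poleWeight a n).contDiffOn
  bounded := by
    refine ⟨Real.toNNReal (2 ^ ((τ : ℝ) / 2) * ((n : ℝ) + 1)⁻¹ ^ (-(τ : ℝ) / 2)), fun z _ => ?_⟩
    rw [Real.norm_of_nonneg (poleWeight_pos a n z).le, Real.coe_toNNReal _ (by positivity)]
    exact poleWeight_le_of_le τ.coe_nonneg (by positivity) fun j =>
      le_add_of_nonneg_left (sq_nonneg _)
  enorm_fderiv_le z hz := by
    have hF : (frontier Ω).Nonempty := ha ▸ (Set.range_nonempty a).closure
    have hd := infDist_frontier_pos hΩ hF hz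
    have h := norm_fderiv_poleWeight_mul_infDist_le a n z τ.coe_nonneg
    rw [← infDist_closure, ha] at h
    rw [boundaryDist_eq_ofReal hF, ← mul_div_assoc, ENNReal.le_div_iff_mul_le
      (.inl (ENNReal.ofReal_pos.2 hd).ne') (.inl ENNReal.ofReal_ne_top), ← ofReal_norm,
      ← ofReal_norm, ← ENNReal.ofReal_coe_nnreal, ← ENNReal.ofReal_mul (norm_nonneg _),
      ← ENNReal.ofReal_mul τ.coe_nonneg, Real.norm_of_nonneg (poleWeight_pos a n z).le]
    exact ENNReal.ofReal_le_ofReal h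

/-! ### The mean value inequality -/

theorem discMass_eq {r : ℝ} (hr : 0 ≤ r) : discMass r = ENNReal.ofReal (Real.pi * r ^ 2) := by
  have hint : IntegrableOn (fun s : ℝ => s) (Set.Ioo 0 r) :=
    continuous_id.integrableOn_Icc.mono_set Set.Ioo_subset_Icc_self
  have hpos : ∀ᵐ s ∂volume.restrict (Set.Ioo 0 r), 0 ≤ s :=
    ae_restrict_of_forall_mem measurableSet_Ioo fun s hs => hs.1.le
  rw [discMass, lintegral_mul_const' _ _ ENNReal.ofReal_ne_top,
    ← ofReal_integral_eq_lintegral_ofReal hint hpos, ← integral_Ioc_eq_integral_Ioo,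
    ← intervalIntegral.integral_of_le hr, integral_id, ← ENNReal.ofReal_mul' (by positivity)]
  congr 1
  ring

theorem enorm_sq_mul_ofReal_le_lintegral_ball {f : ℂ → ℂ} {w : ℂ} {r : ℝ} (hr : 0 ≤ r)
    (hf : DifferentiableOn ℂ f (ball w r)) :
    ‖f w‖ₑ ^ 2 * ENNReal.ofReal (Real.pi * r ^ 2) ≤ ∫⁻ z in ball w r, ‖f z‖ₑ ^ 2 := by
  rw [← discMass_eq hr, ← eLpNorm_two_sq]
  exact enorm_sq_mul_discMass_le hf subset_rfl

theorem MemBergman.eq_zero_of_univ {f : ℂ → ℂ} (hf : MemBergman Set.univ f) : f = 0 := by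
  funext w
  have hle : ∀ n : ℕ, ‖f w‖ₑ ^ 2 * ENNReal.ofReal (Real.pi * n ^ 2) ≤
      eLpNorm f 2 (volume.restrict Set.univ) ^ 2 := fun n => by
    rw [eLpNorm_two_sq]
    exact (enorm_sq_mul_ofReal_le_lintegral_ball n.cast_nonneg
      (hf.1.mono (Set.subset_univ _))).trans (lintegral_mono_set (Set.subset_univ _))
  have hlim : Filter.Tendsto (fun n : ℕ => ENNReal.ofReal (Real.pi * n ^ 2)) Filter.atTop
      (nhds ⊤) :=
    ENNReal.tendsto_ofReal_atTop.comp (((Filter.tendsto_pow_atTop two_ne_zero).comp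
      tendsto_natCast_atTop_atTop).const_mul_atTop Real.pi_pos)
  have htop : ‖f w‖ₑ ^ 2 * ⊤ ≤ eLpNorm f 2 (volume.restrict Set.univ) ^ 2 :=
    le_of_tendsto' (ENNReal.Tendsto.const_mul hlim (.inr (by finiteness))) hle
  by_contra hne
  rw [ENNReal.mul_top (pow_ne_zero 2 (enorm_ne_zero.2 hne)), top_le_iff] at htop
  exact ENNReal.pow_ne_top hf.2.2.ne htop

theorem ball_infDist_frontier_subset {E : Type*} [NormedAddCommGroup E] [NormedSpace ℝ E]
    {s : Set E} {x : E} (hx : x ∈ s) : ball x (infDist x (frontier s)) ⊆ s := by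
  have hdisj : ∀ y ∈ ball x (infDist x (frontier s)), y ∉ frontier s := fun y hy hyF =>
    (infDist_le_dist_of_mem hyF).not_gt (dist_comm y x ▸ mem_ball.1 hy)
  have hunion : ball x (infDist x (frontier s)) ⊆ interior s ∪ (closure s)ᶜ := fun y hy => by
    by_contra h
    rw [Set.mem_union, Set.mem_compl_iff, not_or, not_not] at h
    exact hdisj y hy ⟨h.2, h.1⟩
  intro y hy
  have hxball : x ∈ ball x (infDist x (frontier s)) :=
    mem_ball_self (dist_nonneg.trans_lt (mem_ball.1 hy))
  have hxint : x ∈ interior s := (hunion hxball).resolve_right (not_not.2 (subset_closure hx))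
  exact interior_subset ((convex_ball x _).isPreconnected.subset_left_of_subset_union
    isOpen_interior isClosed_closure.isOpen_compl
    (Set.disjoint_compl_right_iff_subset.2 interior_subset_closure) hunion
    ⟨x, hxball, hxint⟩ hy)

/-! ### Weighted square integrability of the Bergman kernel -/

section BergmanKernel

variable {Ω : Set ℂ} {w : ℂ} {k : ℂ → ℂ}

theorem exists_memLp_forall_memBergman_eq_integral {r : ℝ} (hr : 0 < r) (hrΩ : ball w r ⊆ Ω) :
    ∃ χ : ℂ → ℂ, MemLp χ 2 (volume.restrict Ω) ∧ (∀ z ∉ ball w r, χ z = 0) ∧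
      ∀ f, MemBergman Ω f → f w = ∫ z in Ω, f z * conj (χ z) := by
  obtain ⟨κ, hκ, hrep⟩ := exists_isReproducingAt (isOpen_ball (x := w) (ε := r))
    (mem_ball_self hr)
  refine ⟨(ball w r).indicator κ, ?_, fun z hz => Set.indicator_of_notMem hz κ, fun f hf => ?_⟩
  · exact ((memLp_indicator_iff_restrict measurableSet_ball).2 hκ.2).restrict Ω
  · have hind : (fun z => f z * conj ((ball w r).indicator κ z)) =
        (ball w r).indicator fun z => f z * conj (κ z) := by
      funext z
      by_cases hz : z ∈ ball w r <;> simp [hz]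
    rw [hrep f ⟨hf.1.mono hrΩ, hf.2.mono_measure (Measure.restrict_mono hrΩ le_rfl)⟩, hind,
      setIntegral_indicator measurableSet_ball, Set.inter_eq_right.2 hrΩ]

theorem IsReproducingAt.exists_eLpNorm_poleWeight_mul_le (hk : IsReproducingAt Ω w k)
    (hΩ : IsOpen Ω) (hw : w ∈ Ω) {a : ℕ → ℂ} (ha : closure (Set.range a) = frontier Ω)
    {τ c : ℝ≥0} (hc : c < 1) (hτ : τ ≤ c * hardyConstant Ω) :
    ∃ B : ℝ≥0∞, B ≠ ⊤ ∧ ∀ n,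
      eLpNorm (fun z => poleWeight a τ n z * k z) 2 (volume.restrict Ω) ≤ B := by
  have hF : (frontier Ω).Nonempty := ha ▸ (Set.range_nonempty a).closure
  set d := infDist w (frontier Ω)
  have hd : 0 < d := infDist_frontier_pos hΩ hF hw
  obtain ⟨χ, hχ, hχ0, hχrep⟩ := exists_memLp_forall_memBergman_eq_integral (half_pos hd)
    ((ball_subset_ball (half_le_self hd.le)).trans (ball_infDist_frontier_subset hw))
  set C : ℝ := 2 ^ ((τ : ℝ) / 2) * (d / 2) ^ (-(τ : ℝ))
  have hχC : ∀ n, eLpNorm (fun z => poleWeight a τ n z * χ z) 2 (volume.restrict Ω) ≤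
      ENNReal.ofReal C * eLpNorm χ 2 (volume.restrict Ω) := fun n => by
    refine eLpNorm_le_mul_eLpNorm_of_ae_le_mul (.of_forall fun z => ?_) 2
    by_cases hz : z ∈ ball w (d / 2)
    · have hdz : d / 2 ≤ infDist z (Set.range a) := by
        have hlip : d ≤ infDist z (frontier Ω) + dist w z := infDist_le_infDist_add_dist
        rw [← infDist_closure, ha]
        linarith [mem_ball'.1 hz]
      rw [norm_mul, Complex.norm_real, Real.norm_of_nonneg (poleWeight_pos a n z).le]
      gcongr
      refine (poleWeight_le_rpow_infDist τ.coe_nonneg ((half_pos hd).trans_le hdz)).trans ?_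
      exact mul_le_mul_of_nonneg_left (Real.rpow_le_rpow_of_nonpos (half_pos hd) hdz
        (neg_nonpos.2 τ.coe_nonneg)) (by positivity)
    · simp [hχ0 z hz]
  refine ⟨ENNReal.ofReal (2 / (1 - c)) * (ENNReal.ofReal C * eLpNorm χ 2 (volume.restrict Ω)),
    ENNReal.mul_ne_top ENNReal.ofReal_ne_top (ENNReal.mul_ne_top ENNReal.ofReal_ne_top hχ.2.ne),
    fun n => ?_⟩
  refine ((isHardyWeight_poleWeight hΩ ha τ n).eLpNorm_mul_le hΩ hc hτ hk.1 hχ fun f hf =>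
    (hk.2 f hf).symm.trans (hχrep f hf)).trans ?_
  gcongr
  exact hχC n

theorem IsReproducingAt.lintegral_infDist_rpow_mul_enorm_sq_lt_top (hk : IsReproducingAt Ω w k)
    (hΩ : IsOpen Ω) (hw : w ∈ Ω) (hF : (frontier Ω).Nonempty) {τ c : ℝ≥0} (hc : c < 1)
    (hτ : τ ≤ c * hardyConstant Ω) :
    ∫⁻ z in Ω, (ENNReal.ofReal (infDist z (frontier Ω) ^ (-(τ : ℝ))) * ‖k z‖ₑ) ^ 2 < ⊤ := by
  obtain ⟨a, ha⟩ := exists_closure_range_eq (isClosed_frontier (s := Ω)) hF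
  obtain ⟨B, hB, hle⟩ := hk.exists_eLpNorm_poleWeight_mul_le hΩ hw ha hc hτ
  have hliminf : ∀ z ∈ Ω,
      (ENNReal.ofReal (infDist z (frontier Ω) ^ (-(τ : ℝ))) * ‖k z‖ₑ) ^ 2 ≤
        Filter.liminf (fun n => ‖2 * (poleWeight a τ n z * k z)‖ₑ ^ 2) Filter.atTop :=
    fun z hz => by
      have hd := infDist_frontier_pos hΩ hF hz
      have hhalf := half_lt_self (Real.rpow_pos_of_pos hd (-(τ : ℝ)))
      rw [← ha, infDist_closure] at hd hhalf ⊢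
      refine Filter.le_liminf_of_le (by isBoundedDefault) ?_
      filter_upwards [eventually_lt_poleWeight τ.coe_nonneg hd hhalf] with n hn
      rw [← mul_assoc, enorm_mul, ← ofReal_norm (2 * _ : ℂ), norm_mul, Complex.norm_two,
        Complex.norm_real, Real.norm_of_nonneg (poleWeight_pos a n z).le]
      gcongr
      linarith
  have hmeas : ∀ n, AEMeasurable (fun z => ‖2 * (poleWeight a τ n z * k z)‖ₑ ^ 2)
      (volume.restrict Ω) := fun n =>
    (((isHardyWeight_poleWeight hΩ ha τ n).aestronglyMeasurable_mul hΩ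
      hk.1.2.1).const_mul 2).enorm.pow_const 2
  calc ∫⁻ z in Ω, (ENNReal.ofReal (infDist z (frontier Ω) ^ (-(τ : ℝ))) * ‖k z‖ₑ) ^ 2
      ≤ ∫⁻ z in Ω, Filter.liminf (fun n => ‖2 * (poleWeight a τ n z * k z)‖ₑ ^ 2) Filter.atTop :=
        setLIntegral_mono' hΩ.measurableSet hliminf
    _ ≤ Filter.liminf (fun n => ∫⁻ z in Ω, ‖2 * (poleWeight a τ n z * k z)‖ₑ ^ 2) Filter.atTop :=
        lintegral_liminf_le' hmeas
    _ ≤ (‖(2 : ℂ)‖ₑ * B) ^ 2 := by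
        refine Filter.liminf_le_of_frequently_le' (.of_forall fun n => ?_)
        rw [← eLpNorm_two_sq]
        gcongr
        exact (eLpNorm_const_smul (2 : ℂ) (fun z => poleWeight a τ n z * k z) 2 _).trans_le
          (mul_le_mul_right (hle n) _)
    _ < ⊤ := by finiteness

/-! ### From weighted square integrability to `L^p` -/

theorem ofReal_norm_sq_mul_le_lintegral_infDist_rpow_mul (hΩ : IsOpen Ω)
    (hF : (frontier Ω).Nonempty) {τ : ℝ} (hτ : 0 ≤ τ) (hk : DifferentiableOn ℂ k Ω) {z : ℂ}
    (hz : z ∈ Ω) :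
    ENNReal.ofReal (((3 / 2 * infDist z (frontier Ω)) ^ (-τ) * ‖k z‖) ^ 2 *
        (Real.pi * (infDist z (frontier Ω) / 2) ^ 2)) ≤
      ∫⁻ ζ in Ω, (ENNReal.ofReal (infDist ζ (frontier Ω) ^ (-τ)) * ‖k ζ‖ₑ) ^ 2 := by
  set d := infDist z (frontier Ω)
  have hd : 0 < d := infDist_frontier_pos hΩ hF hz
  have hball : ball z (d / 2) ⊆ Ω :=
    (ball_subset_ball (half_le_self hd.le)).trans (ball_infDist_frontier_subset hz)
  have hweight : ∀ ζ ∈ ball z (d / 2), (3 / 2 * d) ^ (-τ) ≤ infDist ζ (frontier Ω) ^ (-τ) :=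
    fun ζ hζ => by
      have hlip : infDist ζ (frontier Ω) ≤ d + dist ζ z := infDist_le_infDist_add_dist
      exact Real.rpow_le_rpow_of_nonpos (infDist_frontier_pos hΩ hF (hball hζ))
        (by linarith [mem_ball.1 hζ]) (neg_nonpos.2 hτ)
  calc ENNReal.ofReal (((3 / 2 * d) ^ (-τ) * ‖k z‖) ^ 2 * (Real.pi * (d / 2) ^ 2))
      = ENNReal.ofReal ((3 / 2 * d) ^ (-τ)) ^ 2 *
          (‖k z‖ₑ ^ 2 * ENNReal.ofReal (Real.pi * (d / 2) ^ 2)) := by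
        rw [ENNReal.ofReal_mul (by positivity), ENNReal.ofReal_pow (by positivity),
          ENNReal.ofReal_mul (by positivity), ofReal_norm, mul_pow, mul_assoc]
    _ ≤ ENNReal.ofReal ((3 / 2 * d) ^ (-τ)) ^ 2 * ∫⁻ ζ in ball z (d / 2), ‖k ζ‖ₑ ^ 2 := by
        gcongr
        exact enorm_sq_mul_ofReal_le_lintegral_ball (half_pos hd).le (hk.mono hball)
    _ = ∫⁻ ζ in ball z (d / 2), (ENNReal.ofReal ((3 / 2 * d) ^ (-τ)) * ‖k ζ‖ₑ) ^ 2 := by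
        simp only [mul_pow]
        exact (lintegral_const_mul' _ _ (by finiteness)).symm
    _ ≤ ∫⁻ ζ in Ω, (ENNReal.ofReal (infDist ζ (frontier Ω) ^ (-τ)) * ‖k ζ‖ₑ) ^ 2 :=
        (setLIntegral_mono' measurableSet_ball fun ζ hζ => by
          gcongr (ENNReal.ofReal ?_ * _) ^ 2
          exact hweight ζ hζ).trans (lintegral_mono_set hball)

theorem exists_norm_le_mul_infDist_rpow (hΩ : IsOpen Ω) (hF : (frontier Ω).Nonempty) {τ : ℝ}
    (hτ : 0 ≤ τ) (hk : DifferentiableOn ℂ k Ω)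
    (hfin : ∫⁻ z in Ω, (ENNReal.ofReal (infDist z (frontier Ω) ^ (-τ)) * ‖k z‖ₑ) ^ 2 < ⊤) :
    ∃ C : ℝ, 0 ≤ C ∧ ∀ z ∈ Ω, ‖k z‖ ≤ C * infDist z (frontier Ω) ^ (τ - 1) := by
  set A := ∫⁻ z in Ω, (ENNReal.ofReal (infDist z (frontier Ω) ^ (-τ)) * ‖k z‖ₑ) ^ 2
  refine ⟨2 * √A.toReal / (3 / 2) ^ (-τ), by positivity, fun z hz => ?_⟩
  have hA := (ENNReal.ofReal_le_iff_le_toReal hfin.ne).1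
    (ofReal_norm_sq_mul_le_lintegral_infDist_rpow_mul hΩ hF hτ hk hz)
  set d := infDist z (frontier Ω)
  have hd : 0 < d := infDist_frontier_pos hΩ hF hz
  have hsq : ((3 / 2 * d) ^ (-τ) * ‖k z‖ * (d / 2)) ^ 2 ≤ A.toReal := by
    refine le_trans ?_ hA
    rw [mul_pow]
    gcongr
    exact le_mul_of_one_le_left (sq_nonneg _) (by linarith [Real.pi_gt_three])
  have hroot := Real.le_sqrt_of_sq_le hsq
  rw [Real.mul_rpow (by norm_num) hd.le] at hroot
  have hexp : d ^ (τ - 1) = (d ^ (-τ) * d)⁻¹ := by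
    rw [← Real.rpow_add_one hd.ne', ← Real.rpow_neg hd.le]
    congr 1
    ring
  rw [hexp, ← div_eq_mul_inv, div_div, le_div_iff₀ (by positivity)]
  linarith

/-- The pointwise bound turns `‖k‖ ^ (p - 2)` into `δ_Ω ^ ((τ - 1) (p - 2)) = δ_Ω ^ (-2 τ)`, where
`τ = 1 - 2 / p`. -/
theorem rpow_le_rpow_sub_two_mul_sq_of_le_mul_rpow {p C x d : ℝ} (hp : 2 ≤ p) (hC : 0 ≤ C)
    (hx : 0 ≤ x) (hd : 0 < d) (hle : x ≤ C * d ^ (1 - 2 / p - 1)) :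
    x ^ p ≤ C ^ (p - 2) * (d ^ (-(1 - 2 / p)) * x) ^ 2 := by
  have hp0 : p ≠ 0 := by positivity
  calc x ^ p = x ^ (p - 2) * x ^ 2 := by
        rw [← Real.rpow_two, ← Real.rpow_add_of_nonneg hx (sub_nonneg.2 hp) two_pos.le,
          sub_add_cancel]
    _ ≤ (C * d ^ (1 - 2 / p - 1)) ^ (p - 2) * x ^ 2 := by gcongr
    _ = C ^ (p - 2) * (d ^ (-(1 - 2 / p)) * x) ^ 2 := by
        rw [Real.mul_rpow hC (by positivity), mul_pow, mul_assoc, ← Real.rpow_two (d ^ _),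
          ← Real.rpow_mul hd.le, ← Real.rpow_mul hd.le]
        congr 3
        field_simp
        ring

theorem memLp_of_lintegral_infDist_rpow_mul_enorm_sq_lt_top (hΩ : IsOpen Ω)
    (hF : (frontier Ω).Nonempty) {p : ℝ≥0} (hp : 2 ≤ p) (hk : MemBergman Ω k)
    (hfin : ∫⁻ z in Ω,
      (ENNReal.ofReal (infDist z (frontier Ω) ^ (-(1 - 2 / p : ℝ))) * ‖k z‖ₑ) ^ 2 < ⊤) :
    MemLp k p (volume.restrict Ω) := by
  have hp2 : (2 : ℝ) ≤ p := by exact_mod_cast hp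
  have hp0 : (0 : ℝ) < p := by linarith
  obtain ⟨C, hC, hle⟩ := exists_norm_le_mul_infDist_rpow hΩ hF
    (sub_nonneg.2 ((div_le_one hp0).2 hp2)) hk.1 hfin
  refine ⟨hk.2.1, ?_⟩
  rw [eLpNorm_lt_top_iff_lintegral_rpow_enorm_lt_top (by simpa using hp0.ne') ENNReal.coe_ne_top,
    ENNReal.coe_toReal]
  refine (setLIntegral_mono' hΩ.measurableSet fun z hz => ?_).trans_lt
    ((lintegral_const_mul' (ENNReal.ofReal (C ^ ((p : ℝ) - 2))) _ ENNReal.ofReal_ne_top).trans_lt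
      (ENNReal.mul_lt_top ENNReal.ofReal_lt_top hfin))
  have hd : 0 < infDist z (frontier Ω) := infDist_frontier_pos hΩ hF hz
  rw [← ofReal_norm, ENNReal.ofReal_rpow_of_nonneg (norm_nonneg _) hp0.le,
    ← ENNReal.ofReal_mul (by positivity), ← ENNReal.ofReal_pow (by positivity),
    ← ENNReal.ofReal_mul (by positivity)]
  exact ENNReal.ofReal_le_ofReal
    (rpow_le_rpow_sub_two_mul_sq_of_le_mul_rpow hp2 hC (norm_nonneg _) hd (hle z hz))

theorem exists_lt_one_le_mul {τ : ℝ≥0} {h : ℝ≥0∞} (hτ : τ < h) :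
    ∃ c : ℝ≥0, c < 1 ∧ (τ : ℝ≥0∞) ≤ c * h := by
  obtain ⟨t, hτt, hth⟩ := ENNReal.lt_iff_exists_nnreal_btwn.1 hτ
  have hτt' : τ < t := ENNReal.coe_lt_coe.1 hτt
  have ht : t ≠ 0 := hτt'.ne_bot
  refine ⟨τ / t, (div_lt_one (pos_of_ne_zero ht)).2 hτt', ?_⟩
  calc (τ : ℝ≥0∞) = (τ / t : ℝ≥0) * t := by rw [← ENNReal.coe_mul, div_mul_cancel₀ _ ht]
    _ ≤ (τ / t : ℝ≥0) * h := by gcongr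

theorem IsReproducingAt.memLp (hk : IsReproducingAt Ω w k) (hΩ : IsOpen Ω) (hw : w ∈ Ω)
    {p : ℝ≥0} (hp : 2 ≤ p) (hh : 1 - 2 / (p : ℝ≥0∞) < hardyConstant Ω) :
    MemLp k p (volume.restrict Ω) := by
  rcases (frontier Ω).eq_empty_or_nonempty with hF | hF
  · obtain rfl | rfl := frontier_eq_empty_iff.1 hF
    · exact absurd hw (Set.notMem_empty w)
    · rw [hk.1.eq_zero_of_univ]
      exact MemLp.zero
  · have hτ : 1 - 2 / (p : ℝ≥0∞) = (1 - 2 / p : ℝ≥0) := by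
      rw [ENNReal.coe_sub, ENNReal.coe_div (two_pos.trans_le hp).ne', ENNReal.coe_one,
        ENNReal.coe_ofNat]
    obtain ⟨c, hc, hle⟩ := exists_lt_one_le_mul (hτ ▸ hh)
    have hfin := hk.lintegral_infDist_rpow_mul_enorm_sq_lt_top hΩ hw hF hc hle
    rw [NNReal.coe_sub (div_le_one_of_le₀ hp zero_le)] at hfin
    exact memLp_of_lintegral_infDist_rpow_mul_enorm_sq_lt_top hΩ hF hp hk.1 hfin

theorem le_integrabilityIndex {p : ℝ≥0} (hp : 2 ≤ p)
    (h : ∀ w ∈ Ω, MemLp (fun z => bergmanKernel Ω z w) p (volume.restrict Ω)) :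
    p ≤ integrabilityIndex Ω :=
  le_iSup₂_of_le (f := fun (p : ℝ≥0) _ => (p : ℝ≥0∞)) p ⟨hp, h⟩ le_rfl

theorem two_le_integrabilityIndex (hΩ : IsOpen Ω) : 2 ≤ integrabilityIndex Ω :=
  le_integrabilityIndex le_rfl fun _ hw => (bergmanKernel_spec hΩ hw).1.2

end BergmanKernel

end

theorem theorem1p2_general (Ω : Set ℂ) (hΩ : IsOpen Ω) :
    2 / (1 - hardyConstant Ω) ≤ integrabilityIndex Ω := by
  refine ENNReal.le_of_forall_nnreal_lt fun p hp => ?_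
  rcases le_total p 2 with hp2 | hp2
  · exact (ENNReal.coe_le_coe.2 hp2).trans (two_le_integrabilityIndex hΩ)
  have hp0 : (p : ℝ≥0∞) ≠ 0 := ENNReal.coe_ne_zero.2 (two_pos.trans_le hp2).ne'
  have hlt : 1 - hardyConstant Ω < 2 / p := by
    rw [ENNReal.lt_div_iff_mul_lt (.inl hp0) (.inl ENNReal.coe_ne_top), mul_comm]
    exact (ENNReal.lt_div_iff_mul_lt (.inr ENNReal.coe_ne_top) (.inr hp0)).1 hp
  have hle : 2 / (p : ℝ≥0∞) ≤ 1 :=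
    ENNReal.div_le_of_le_mul (by rw [one_mul]; exact_mod_cast hp2)
  exact le_integrabilityIndex hp2 fun w hw => (bergmanKernel_spec hΩ hw).memLp hΩ hw hp2
    (ENNReal.sub_lt_of_sub_lt hle (.inl ENNReal.one_ne_top) hlt)

theorem six_div_three_sub_le_two_div_one_sub (h : ℝ≥0∞) : 6 / (3 - h) ≤ 2 / (1 - h) :=
  calc 6 / (3 - h) ≤ 3 * 2 / (3 * (1 - h)) := by
        gcongr
        · norm_num
        · rw [ENNReal.mul_sub fun _ _ => ENNReal.ofNat_ne_top, mul_one]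
          exact tsub_le_tsub_left (le_mul_of_one_le_left zero_le (by norm_num)) 3
    _ = 2 / (1 - h) := ENNReal.mul_div_mul_left _ _ three_ne_zero ENNReal.ofNat_ne_top

theorem theorem1p2 (Ω : Set ℂ) (hopen : IsOpen Ω) (hconn : IsConnected Ω) :
    6 / (3 - hardyConstant Ω) ≤ integrabilityIndex Ω :=
  (six_div_three_sub_le_two_div_one_sub _).trans (theorem1p2_general Ω hopen)
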